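/- Let $p,m\ge 1$, and equip $\mathbb R^p$ and $\mathbb R^m$ with the Euclidean norm $\|\cdot\|$ and with Lebesgue measure. Let $\pi$ be a probability density on $\mathbb R^p$ (the prior) and let $f(\cdot\,|\,\theta)$, $\theta\in\mathbb R^p$, be a jointly measurable family of conditional probability densities on $\mathbb R^m$. Put $f(\theta,s)=f(s\,|\,\theta)\pi(\theta)$ (the joint density), $\bar f(s)=\int_{\mathbb R^p} f(\theta,s)\,d\theta$ and, when $\bar f(s)>0$, $g(\theta\,|\,s)=f(\theta,s)/\bar f(s)$ (the posterior density). Let $(\Theta_1,S_1),(\Theta_2,S_2),\dots$ be i.i.d. random pairs in $\mathbb R^p\times\mathbb R^m$ with density $f$. For $s_0\in\mathbb R^m$ and $N\ge 2$ let $S_{(1)},\dots,S_{(N)}$ be $S_1,\dots,S_N$ rearranged by increasing distance $\|S_i-s_0\|$ (ties broken by indices), and let $\Theta_{(1)},\dots,\Theta_{(N)}$ be the corresponding $\Theta_i$'s. Given integers $1\le k_N\le N-1$, bandwidths $h_N>0$ and a kernel $K:\mathbb R^p\to\mathbb R$, set $$\hat g_N(\theta_0)=\frac{1}{k_Nh_N^p}\sum_{j=1}^{k_N}K\!\left(\frac{\theta_0-\Theta_{(j)}}{h_N}\right),\qquad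 \theta_0\in\mathbb R^p .$$ Assume that $K$ is nonnegative and Borel measurable, that $K\in L^1(\mathbb R^p)\cap L^2(\mathbb R^p)$ with $\int_{\mathbb R^p}K(\theta)\,d\theta=1$, and that $\theta\mapsto\sup_{\|y\|\ge\|\theta\|}|K(y)|$ is in $L^1(\mathbb R^p)$. Assume also that $f\in L^2(\mathbb R^p\times\mathbb R^m)$ and $\pi\in L^2(\mathbb R^p)$. Then for Lebesgue-almost every $s_0\in\mathbb R^m$ with $\bar f(s_0)>0$ the following holds: for all sequences $(k_N)$ and $(h_N)$ as above such that $k_N\to\infty$, $k_N/N\to 0$, $h_N\to 0$ and $k_Nh_N^p\to\infty$, $$\mathbb E\left[\int_{\mathbb R^p}\bigl(\hat g_N(\theta_0)-g(\theta_0\,|\,s_0)\bigr)^2\,d\theta_0\right]\to 0\qquad\text{as }N\to\infty .$$ -/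

import Mathlib

open MeasureTheory ProbabilityTheory Filter Topology
open scoped ENNReal

/-- `ℝⁿ` with the Euclidean norm and Lebesgue measure. -/
abbrev E (n : ℕ) : Type := EuclideanSpace ℝ (Fin n)

noncomputable section

/-- The radially decreasing envelope `θ ↦ sup_{‖y‖ ≥ ‖θ‖} |K y|`, with values in `[0, ∞]`
(it may be infinite at the origin). -/
def radialEnvelope {p : ℕ} (K : E p → ℝ) (θ : E p) : ℝ≥0∞ :=
  ⨆ (y : E p) (_ : ‖θ‖ ≤ ‖y‖), ‖K y‖ₑ

/-- A Borel measurable kernel satisfying Assumption [K1]: it is nonnegative and integrable with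
integral one, and its radially decreasing envelope is integrable. -/
structure IsKernelK1 {p : ℕ} (K : E p → ℝ) : Prop where
  measurable : Measurable K
  nonneg : ∀ θ, 0 ≤ K θ
  integrable : Integrable K
  integral_eq_one : ∫ θ, K θ = 1
  envelope_integrable : ∫⁻ θ, radialEnvelope K θ < ∞

/-- The Bayesian model: `prior` is a probability density `π` on `ℝᵖ` and `lik θ s = f(s | θ)` is a
conditional probability density of the statistic given the parameter `θ` (for almost every `θ`
that the prior charges). -/
structure IsBayesModel {p m : ℕ} (prior : E p → ℝ) (lik : E p → E m → ℝ) : Prop where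
  prior_measurable : Measurable prior
  prior_nonneg : ∀ θ, 0 ≤ prior θ
  prior_integral : ∫ θ, prior θ = 1
  lik_measurable : Measurable (Function.uncurry lik)
  lik_nonneg : ∀ θ s, 0 ≤ lik θ s
  lik_integral : ∀ᵐ θ, prior θ ≠ 0 → ∫ s, lik θ s = 1

/-- The joint density `f(θ, s) = f(s | θ) π(θ)` of parameter and statistic. -/
def jointDensity {p m : ℕ} (prior : E p → ℝ) (lik : E p → E m → ℝ) (x : E p × E m) : ℝ :=
  lik x.1 x.2 * prior x.1

/-- The marginal density of the statistic, `f̄(s) = ∫ f(s | θ) π(θ) dθ`. -/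
def marginalDensity {p m : ℕ} (prior : E p → ℝ) (lik : E p → E m → ℝ) (s : E m) : ℝ :=
  ∫ θ, jointDensity prior lik (θ, s)

/-- The posterior density `g(θ | s) = f(s | θ) π(θ) / f̄(s)`. -/
def posteriorDensity {p m : ℕ} (prior : E p → ℝ) (lik : E p → E m → ℝ) (θ : E p) (s : E m) : ℝ :=
  jointDensity prior lik (θ, s) / marginalDensity prior lik s

/-- `(Θ i, S i)`, `i = 0, 1, …`, are i.i.d. random pairs with density `f(θ, s) = f(s | θ) π(θ)`
with respect to Lebesgue measure on `ℝᵖ × ℝᵐ`. -/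
structure IsIIDSample {p m : ℕ} (prior : E p → ℝ) (lik : E p → E m → ℝ)
    {Ω : Type*} [MeasurableSpace Ω] (P : Measure Ω)
    (Θ : ℕ → Ω → E p) (S : ℕ → Ω → E m) : Prop where
  measurable_param : ∀ i, Measurable (Θ i)
  measurable_stat : ∀ i, Measurable (S i)
  indep : iIndepFun (fun i ω => (Θ i ω, S i ω)) P
  law : ∀ i, P.map (fun ω => (Θ i ω, S i ω)) =
    volume.withDensity (fun x => ENNReal.ofReal (jointDensity prior lik x))

/-- The permutation that lists the points `s 0, …, s (N - 1)` by increasing distance to `s₀`, ties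
being broken by indices: the `j`-th nearest neighbour of `s₀` (counting from `j = 0`) is
`s (nearestOrder s₀ s j)`. -/
def nearestOrder {m N : ℕ} (s₀ : E m) (s : Fin N → E m) : Equiv.Perm (Fin N) :=
  Tuple.sort (fun i => ‖s i - s₀‖)

/-- The estimate `ĝ(θ₀) = (k hᵖ)⁻¹ ∑_{j ≤ k} K ((θ₀ - Θ_(j)) / h)`, where `Θ_(j)` is the parameter
that goes with the `j`-th nearest neighbour of `s₀` among the simulated statistics. -/
def abcEstimate {p m N : ℕ} (K : E p → ℝ) (k : ℕ) (h : ℝ) (s₀ : E m)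
    (θ : Fin N → E p) (s : Fin N → E m) (θ₀ : E p) : ℝ :=
  1 / ((k : ℝ) * h ^ p) *
    ∑ j ∈ (Finset.univ : Finset (Fin N)).filter (fun j => j.val < k),
      K (h⁻¹ • (θ₀ - θ (nearestOrder s₀ s j)))

/-- The mean integrated square error `𝔼 ∫ (ĝ_N(θ₀) - g(θ₀ | s₀))² dθ₀`, in `[0, ∞]`, of the
estimate built on the first `N` sample points. -/
def mise {p m : ℕ} (prior : E p → ℝ) (lik : E p → E m → ℝ)
    {Ω : Type*} [MeasurableSpace Ω] (P : Measure Ω)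
    (Θ : ℕ → Ω → E p) (S : ℕ → Ω → E m)
    (K : E p → ℝ) (s₀ : E m) (N k : ℕ) (h : ℝ) : ℝ≥0∞ :=
  ∫⁻ ω, (∫⁻ θ₀ : E p, ENNReal.ofReal
    ((abcEstimate K k h s₀ (fun i : Fin N => Θ i ω) (fun i : Fin N => S i ω) θ₀
      - posteriorDensity prior lik θ₀ s₀) ^ 2)) ∂P

end

/-!
The error is computed conditionally on the distance `D` from `s₀` to its `(k + 1)`-st nearest
neighbour. Given `D = r`, the `k` nearest pairs are, up to their order, an i.i.d. sample from the
joint law conditioned on the statistic lying in the ball of radius `r` (`lintegral_nearest_le`), so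
the estimate is an ordinary kernel density estimate based on a sample from the density `G r` of the
parameter given that ball (`ballDensity`). This is exact because the estimate is symmetric in the
`k` nearest pairs and because there are almost surely no ties.

For a kernel density estimate, independence and Jensen's inequality give
`𝔼 ‖ĝ - g‖² ≤ ‖K‖² / (k hᵖ) + 2 ‖G r - g‖² + 2 ∫ K u ‖g (· - h u) - g‖² du`
(`lintegral_kernelDensityEstimate_sub_sq_le`), where `g` is the posterior density at `s₀`. The first
term vanishes since `k hᵖ → ∞`, the last one by continuity of translations in `L²`.

There remains `𝔼 ‖G D - g‖²`. Lebesgue's differentiation theorem for the `L²`-valued map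
`s ↦ f (·, s)` shows that, for almost every `s₀` with positive marginal density, `G r → g` in `L²` as
`r → 0` (`ae_tendsto_lintegral_ballDensity_sub_sq`); this is where `f ∈ L²` is used. So the
contribution of `D < δ` is small. If `D ≥ δ`, then `G D` is at most the prior density divided by the
probability of the ball of radius `δ`, hence bounded in `L²` because the prior is in `L²`; and
`D ≥ δ` means that at most `k` of the `N` points fall in that ball, which is unlikely as `k / N → 0`
(`tendsto_measure_card_le`).

All errors are Lebesgue integrals with values in `[0, ∞]`, so that no integrability has to be
checked along the way.
-/

/-! ### Squared distances in `[0, ∞]` -/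

lemma ofReal_sub_sq_le (a b c : ℝ) :
    ENNReal.ofReal ((a - b) ^ 2) ≤
      2 * ENNReal.ofReal ((a - c) ^ 2) + 2 * ENNReal.ofReal ((c - b) ^ 2) := by
  have h2 : (2 : ℝ≥0∞) = ENNReal.ofReal 2 := by simp
  rw [h2, ← ENNReal.ofReal_mul zero_le_two, ← ENNReal.ofReal_mul zero_le_two,
    ← ENNReal.ofReal_add (by positivity) (by positivity)]
  exact ENNReal.ofReal_le_ofReal (by nlinarith [sq_nonneg (a - c - (c - b))])

lemma ofReal_sub_sq_comm (a b : ℝ) :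
    ENNReal.ofReal ((a - b) ^ 2) = ENNReal.ofReal ((b - a) ^ 2) := by
  congr 1; ring

lemma lintegral_ofReal_sub_sq_le {α : Type*} [MeasurableSpace α] {μ : Measure α}
    {a b c : α → ℝ} (ha : Measurable a) (hc : Measurable c) :
    ∫⁻ x, ENNReal.ofReal ((a x - b x) ^ 2) ∂μ ≤
      2 * ∫⁻ x, ENNReal.ofReal ((a x - c x) ^ 2) ∂μ
        + 2 * ∫⁻ x, ENNReal.ofReal ((c x - b x) ^ 2) ∂μ := by
  rw [← lintegral_const_mul' _ _ (by simp), ← lintegral_const_mul' _ _ (by simp),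
    ← lintegral_add_left (by fun_prop)]
  exact lintegral_mono fun x => ofReal_sub_sq_le _ _ _

lemma eLpNorm_two_sq_eq_lintegral {α : Type*} [MeasurableSpace α] {μ : Measure α} (g : α → ℝ) :
    eLpNorm g 2 μ ^ 2 = ∫⁻ x, ENNReal.ofReal (g x ^ 2) ∂μ := by
  have h := eLpNorm_nnreal_pow_eq_lintegral (μ := μ) (f := g) (p := 2) (by norm_num)
  have h' : eLpNorm g 2 μ ^ (2 : ℝ) = ∫⁻ x, ‖g x‖ₑ ^ (2 : ℝ) ∂μ := by simpa using h
  rw [← ENNReal.rpow_natCast]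
  push_cast
  rw [h']
  refine lintegral_congr fun x => ?_
  rw [← ofReal_norm, ENNReal.ofReal_rpow_of_nonneg (norm_nonneg _) (by norm_num)]
  simp

lemma memLp_two_of_lintegral_sq {α : Type*} [MeasurableSpace α] {μ : Measure α} {g : α → ℝ}
    (hg : Measurable g) (h : ∫⁻ x, ENNReal.ofReal (g x ^ 2) ∂μ ≠ ∞) : MemLp g 2 μ := by
  refine ⟨hg.aestronglyMeasurable, ?_⟩
  rw [← eLpNorm_two_sq_eq_lintegral] at h
  exact lt_of_le_of_ne le_top fun h' => h (by simp [h'])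

lemma lintegral_sq_ne_top_of_memLp {α : Type*} [MeasurableSpace α] {μ : Measure α} {g : α → ℝ}
    (h : MemLp g 2 μ) : ∫⁻ x, ENNReal.ofReal (g x ^ 2) ∂μ ≠ ∞ := by
  rw [← eLpNorm_two_sq_eq_lintegral]
  exact ENNReal.pow_ne_top h.2.ne

/-! ### Lebesgue differentiation in `L²` -/

/-- Square integrable functions are approximated by the members of a countable family. -/
lemma exists_countable_dense_sq (p : ℕ) :
    ∃ c : ℕ → E p → ℝ, (∀ n, Measurable (c n)) ∧
      (∀ n, ∫⁻ θ, ENNReal.ofReal (c n θ ^ 2) ≠ ∞) ∧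
      ∀ g : E p → ℝ, Measurable g → ∫⁻ θ, ENNReal.ofReal (g θ ^ 2) ≠ ∞ →
        ∀ ε : ℝ≥0∞, ε ≠ 0 → ∃ n, ∫⁻ θ, ENNReal.ofReal ((g θ - c n θ) ^ 2) < ε := by
  have : Fact ((2 : ℝ≥0∞) ≠ ∞) := ⟨by simp⟩
  let u : ℕ → Lp ℝ 2 (volume : Measure (E p)) := TopologicalSpace.denseSeq _
  refine ⟨fun n => u n, fun n => (Lp.stronglyMeasurable _).measurable,
    fun n => lintegral_sq_ne_top_of_memLp (Lp.memLp _), fun g hg hg2 ε hε => ?_⟩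
  have hgL := memLp_two_of_lintegral_sq hg hg2
  obtain ⟨n, hn⟩ := (TopologicalSpace.denseRange_denseSeq
    (Lp ℝ 2 (volume : Measure (E p)))).exists_mem_open
      (Metric.isOpen_eball (x := hgL.toLp g) (ε := ε ^ (1 / 2 : ℝ)))
      ⟨hgL.toLp g, Metric.mem_eball_self (by simpa [pos_iff_ne_zero] using hε)⟩
  refine ⟨n, ?_⟩
  rw [Metric.mem_eball, edist_comm, Lp.edist_def] at hn
  rw [← eLpNorm_two_sq_eq_lintegral (fun θ => g θ - u n θ)]
  have he : eLpNorm (fun θ => g θ - u n θ) 2 volume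
      = eLpNorm (⇑(hgL.toLp g) - ⇑(u n)) 2 volume := by
    refine eLpNorm_congr_ae ?_
    filter_upwards [hgL.coeFn_toLp] with θ h
    simp [h]
  rw [he]
  calc _ < (ε ^ (1 / 2 : ℝ)) ^ 2 := by
        gcongr
    _ = ε := by
        rw [← ENNReal.rpow_natCast, ← ENNReal.rpow_mul]; norm_num

lemma ae_tendsto_lintegral_ball_div {m : ℕ} {φ : E m → ℝ≥0∞} (hφ : Measurable φ)
    (hloc : ∀ R : ℝ, ∫⁻ s in Metric.closedBall 0 R, φ s ≠ ∞) :
    ∀ᵐ s₀ : E m, Tendsto (fun r => (∫⁻ s in Metric.ball s₀ r, φ s)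
      / volume (Metric.ball s₀ r)) (𝓝[>] 0) (𝓝 (φ s₀)) := by
  have : IsLocallyFiniteMeasure ((volume : Measure (E m)).withDensity φ) := by
    refine ⟨fun x => ⟨Metric.closedBall 0 (‖x‖ + 1), ?_, ?_⟩⟩
    · refine mem_of_superset (Metric.closedBall_mem_nhds x zero_lt_one) ?_
      exact Metric.closedBall_subset_closedBall' (by simp [add_comm])
    · rw [withDensity_apply _ Metric.isClosed_closedBall.measurableSet]
      exact (hloc _).lt_top
  filter_upwards [Besicovitch.ae_tendsto_rnDeriv (volume.withDensity φ) (volume : Measure (E m)),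
    Measure.rnDeriv_withDensity (volume : Measure (E m)) hφ] with s₀ h1 h2
  rw [h2] at h1
  refine h1.congr' ?_
  filter_upwards [self_mem_nhdsWithin] with r hr
  have hvol : volume (Metric.closedBall s₀ r) = volume (Metric.ball s₀ r) := by
    rw [Measure.addHaar_closedBall volume s₀ (le_of_lt hr),
      Measure.addHaar_ball_of_pos volume s₀ hr]
  have hae : Metric.ball s₀ r =ᵐ[volume] Metric.closedBall s₀ r :=
    ae_eq_of_subset_of_measure_ge Metric.ball_subset_closedBall hvol.le
      Metric.isOpen_ball.measurableSet.nullMeasurableSet measure_closedBall_lt_top.ne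
  rw [withDensity_apply _ Metric.isClosed_closedBall.measurableSet, hvol,
    setLIntegral_congr hae]

/-- **Lebesgue differentiation** for the `L²(ℝᵖ)`-valued map `s ↦ f (·, s)`, in strong form: almost
every `s₀` is a point where the mean of `‖f (·, s) - f (·, s₀)‖²` over small balls tends to zero.
The scalar theorem is applied to `s ↦ ‖f (·, s) - c‖²`, for `c` in a countable dense family. -/
theorem ae_tendsto_average_sq_dist_section {p m : ℕ} {f : E p × E m → ℝ} (hf : Measurable f)
    (hf2 : ∫⁻ x, ENNReal.ofReal (f x ^ 2) ≠ ∞) :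
    ∀ᵐ s₀ : E m, Tendsto (fun r =>
      (∫⁻ s in Metric.ball s₀ r, ∫⁻ θ, ENNReal.ofReal ((f (θ, s) - f (θ, s₀)) ^ 2))
        / volume (Metric.ball s₀ r)) (𝓝[>] 0) (𝓝 0) := by
  obtain ⟨c, hcm, hc2, hc⟩ := exists_countable_dense_sq p
  have hF : ∫⁻ s, ∫⁻ θ, ENNReal.ofReal (f (θ, s) ^ 2) ≠ ∞ := by
    rw [← lintegral_prod_symm' (fun x => ENNReal.ofReal (f x ^ 2)) (by fun_prop)]
    exact hf2
  have hFm : Measurable fun s => ∫⁻ θ, ENNReal.ofReal (f (θ, s) ^ 2) :=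
    Measurable.lintegral_prod_left' (f := fun x => ENNReal.ofReal (f x ^ 2)) (by fun_prop)
  have hφm : ∀ n, Measurable fun s => ∫⁻ θ, ENNReal.ofReal ((f (θ, s) - c n θ) ^ 2) := fun n =>
    Measurable.lintegral_prod_left'
      (f := fun x : E p × E m => ENNReal.ofReal ((f x - c n x.1) ^ 2)) (by
        have := hcm n
        fun_prop)
  have hlim : ∀ n, ∀ᵐ s₀ : E m, Tendsto (fun r =>
      (∫⁻ s in Metric.ball s₀ r, ∫⁻ θ, ENNReal.ofReal ((f (θ, s) - c n θ) ^ 2))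
        / volume (Metric.ball s₀ r)) (𝓝[>] 0)
        (𝓝 (∫⁻ θ, ENNReal.ofReal ((f (θ, s₀) - c n θ) ^ 2))) := by
    refine fun n => ae_tendsto_lintegral_ball_div (hφm n) fun R => ne_of_lt ?_
    calc ∫⁻ s in Metric.closedBall 0 R, ∫⁻ θ, ENNReal.ofReal ((f (θ, s) - c n θ) ^ 2)
        ≤ ∫⁻ s in Metric.closedBall 0 R, (2 * (∫⁻ θ, ENNReal.ofReal (f (θ, s) ^ 2))
            + 2 * ∫⁻ θ, ENNReal.ofReal (c n θ ^ 2)) := by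
          refine lintegral_mono fun s => ?_
          simpa using lintegral_ofReal_sub_sq_le (μ := (volume : Measure (E p)))
            (a := fun θ => f (θ, s)) (b := c n) (c := fun _ => 0) (by fun_prop) (by fun_prop)
      _ = 2 * (∫⁻ s in Metric.closedBall 0 R, ∫⁻ θ, ENNReal.ofReal (f (θ, s) ^ 2))
            + 2 * (∫⁻ θ, ENNReal.ofReal (c n θ ^ 2)) * volume (Metric.closedBall (0 : E m) R) := by
          rw [lintegral_add_right _ measurable_const, lintegral_const_mul _ hFm]
          simp
      _ < ∞ := by
          refine ENNReal.add_lt_top.2 ⟨ENNReal.mul_lt_top (by simp) ?_,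
            ENNReal.mul_lt_top (ENNReal.mul_lt_top (by simp) (hc2 n).lt_top) ?_⟩
          · exact (setLIntegral_le_lintegral _ _).trans_lt hF.lt_top
          · exact measure_closedBall_lt_top
  filter_upwards [ae_all_iff.2 hlim, ae_lt_top hFm hF] with s₀ hs hs2
  rw [ENNReal.tendsto_nhds_zero]
  intro ε hε
  have hε4 : ε / 4 ≠ 0 := (ENNReal.div_pos hε.ne' (by simp)).ne'
  obtain ⟨n, hn⟩ := hc (fun θ => f (θ, s₀)) (by fun_prop) hs2.ne (ε / 4) hε4
  filter_upwards [(tendsto_order.1 (hs n)).2 _ hn, self_mem_nhdsWithin] with r hr hr0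
  have hV0 : volume (Metric.ball s₀ r) ≠ 0 :=
    (Metric.measure_ball_pos volume s₀ hr0).ne'
  have hVt : volume (Metric.ball s₀ r) ≠ ∞ := measure_ball_lt_top.ne
  calc (∫⁻ s in Metric.ball s₀ r, ∫⁻ θ, ENNReal.ofReal ((f (θ, s) - f (θ, s₀)) ^ 2))
        / volume (Metric.ball s₀ r)
      ≤ (∫⁻ s in Metric.ball s₀ r,
          (2 * (∫⁻ θ, ENNReal.ofReal ((f (θ, s) - c n θ) ^ 2))
            + 2 * ∫⁻ θ, ENNReal.ofReal ((f (θ, s₀) - c n θ) ^ 2)))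
        / volume (Metric.ball s₀ r) := by
        gcongr with s
        simp_rw [ofReal_sub_sq_comm (f (_, s₀)) (c n _)]
        exact lintegral_ofReal_sub_sq_le (by fun_prop) (hcm n)
    _ = 2 * ((∫⁻ s in Metric.ball s₀ r, ∫⁻ θ, ENNReal.ofReal ((f (θ, s) - c n θ) ^ 2))
          / volume (Metric.ball s₀ r))
        + 2 * ∫⁻ θ, ENNReal.ofReal ((f (θ, s₀) - c n θ) ^ 2) := by
        rw [lintegral_add_right _ measurable_const, lintegral_const_mul _ (hφm n),
          setLIntegral_const, ENNReal.add_div, mul_div_assoc,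
          ENNReal.mul_div_cancel_right hV0 hVt]
    _ ≤ 2 * (ε / 4) + 2 * (ε / 4) := by gcongr
    _ = ε := by
        rw [← add_mul, ← two_mul]
        norm_num
        exact ENNReal.mul_div_cancel (by simp) (by simp)

/-! ### Translations in `L²` -/

lemma tendsto_lintegral_translate_sub_sq {p : ℕ} {g : E p → ℝ} (hg : Measurable g)
    (hg2 : ∫⁻ θ, ENNReal.ofReal (g θ ^ 2) ≠ ∞) :
    Tendsto (fun v : E p => ∫⁻ θ, ENNReal.ofReal ((g (θ - v) - g θ) ^ 2)) (𝓝 0) (𝓝 0) := by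
  have hgL := memLp_two_of_lintegral_sq hg hg2
  let τ : E p → C(E p, E p) :=
    (ContinuousMap.mk (fun a : E p × E p => a.2 - a.1) (by fun_prop)).curry
  have hτ : ∀ v, MeasurePreserving (τ v) (volume : Measure (E p)) volume :=
    fun v => measurePreserving_sub_right volume v
  have hcont : Continuous τ := ContinuousMap.continuous _
  have h := (hcont.tendsto 0)
  have h2 := (tendsto_const_nhds (x := hgL.toLp g)).compMeasurePreservingLp h hτ (hτ 0)
    (by simp)
  rw [tendsto_iff_edist_tendsto_0] at h2
  have h3 := (ENNReal.continuous_pow 2).tendsto 0 |>.comp h2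
  simp only [ne_eq, OfNat.ofNat_ne_zero, not_false_eq_true, zero_pow] at h3
  refine h3.congr fun v => ?_
  rw [Function.comp_apply, Lp.edist_def, eLpNorm_two_sq_eq_lintegral]
  refine lintegral_congr_ae ?_
  have e1 : ∀ v, Lp.compMeasurePreserving (τ v) (hτ v) (hgL.toLp g)
      =ᵐ[volume] fun θ => g (θ - v) := by
    intro v
    refine (Lp.coeFn_compMeasurePreserving _ (hτ v)).trans ?_
    exact (hτ v).quasiMeasurePreserving.ae_eq_comp hgL.coeFn_toLp
  filter_upwards [e1 v, e1 0] with θ h1 h2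
  rw [Pi.sub_apply, h1, h2, sub_zero]

/-- Convolution with a rescaled kernel is an approximate identity in `L²`, in the form in which
it is needed: the mean of `‖g(· - h u) - g‖²` under the kernel vanishes as `h → 0`. -/
theorem tendsto_lintegral_kernel_translate {p : ℕ} {g : E p → ℝ} (hg : Measurable g)
    (hg2 : ∫⁻ θ, ENNReal.ofReal (g θ ^ 2) ≠ ∞) {K : E p → ℝ≥0∞} (hK : Measurable K)
    (hK1 : ∫⁻ u, K u ≠ ∞) :
    Tendsto (fun h : ℝ => ∫⁻ u, K u * ∫⁻ θ, ENNReal.ofReal ((g (θ - h • u) - g θ) ^ 2))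
      (𝓝 0) (𝓝 0) := by
  have hbd : ∀ v : E p, ∫⁻ θ, ENNReal.ofReal ((g (θ - v) - g θ) ^ 2)
      ≤ 4 * ∫⁻ θ, ENNReal.ofReal (g θ ^ 2) := by
    intro v
    have h := lintegral_ofReal_sub_sq_le (μ := (volume : Measure (E p)))
      (a := fun θ => g (θ - v)) (b := g) (c := fun _ => 0) (by fun_prop) (by fun_prop)
    simp only [sub_zero, zero_sub, even_two, Even.neg_pow] at h
    rw [lintegral_sub_right_eq_self (fun θ => ENNReal.ofReal (g θ ^ 2)), ← add_mul] at h
    norm_num at h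
    exact h
  have hm : ∀ h : ℝ, Measurable fun u : E p =>
      K u * ∫⁻ θ, ENNReal.ofReal ((g (θ - h • u) - g θ) ^ 2) := by
    intro h
    refine hK.mul (Measurable.lintegral_prod_right'
      (f := fun x : E p × E p => ENNReal.ofReal ((g (x.2 - h • x.1) - g x.2) ^ 2)) ?_)
    fun_prop
  have hlim := tendsto_lintegral_filter_of_dominated_convergence (μ := (volume : Measure (E p)))
    (l := 𝓝 (0 : ℝ))
    (F := fun h u => K u * ∫⁻ θ, ENNReal.ofReal ((g (θ - h • u) - g θ) ^ 2))
    (f := fun _ => 0)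
    (fun u => K u * (4 * ∫⁻ θ, ENNReal.ofReal (g θ ^ 2)))
    (Eventually.of_forall hm)
    (Eventually.of_forall fun h => Eventually.of_forall fun u => by gcongr; exact hbd _)
    (by
      rw [lintegral_mul_const _ hK]
      exact ENNReal.mul_ne_top hK1 (ENNReal.mul_ne_top (by simp) hg2))
    (by
      filter_upwards [ae_lt_top hK hK1] with u hu
      have h1 : Tendsto (fun h : ℝ => h • u) (𝓝 0) (𝓝 0) := by
        have : Continuous fun h : ℝ => h • u := by fun_prop
        simpa using this.tendsto 0
      have h2 := (tendsto_lintegral_translate_sub_sq hg hg2).comp h1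
      simpa using ENNReal.Tendsto.const_mul h2 (Or.inr hu.ne))
  simpa using hlim

/-! ### Mean square error of an average, and of a kernel density estimate -/

/-- Jensen's inequality for the square, without an integrability hypothesis: if `G` is not square
integrable the right-hand side is infinite. -/
lemma ofReal_integral_sub_sq_le {α : Type*} [MeasurableSpace α] {κ : Measure α}
    [IsProbabilityMeasure κ] {G : α → ℝ} (hG : Measurable G) (c : ℝ) :
    ENNReal.ofReal ((∫ x, G x ∂κ - c) ^ 2) ≤ ∫⁻ x, ENNReal.ofReal ((G x - c) ^ 2) ∂κ := by
  by_cases htop : ∫⁻ x, ENNReal.ofReal ((G x - c) ^ 2) ∂κ = ∞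
  · simp [htop]
  have hW : MemLp (fun x => G x - c) 2 κ := memLp_two_of_lintegral_sq (by fun_prop) htop
  have hGi : Integrable G κ := by
    have h := (hW.integrable (by norm_num)).add (integrable_const c)
    exact h.congr (Eventually.of_forall fun x => by simp)
  rw [← ofReal_integral_eq_lintegral_ofReal hW.integrable_sq
    (Eventually.of_forall fun x => sq_nonneg _)]
  refine ENNReal.ofReal_le_ofReal ?_
  have h := variance_nonneg (fun x => G x - c) κ
  rw [variance_eq_sub hW, integral_sub hGi (integrable_const c)] at h
  simpa using h

/-- Bias-variance bound for the mean of an i.i.d. family, as an estimator of a number `c`. -/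
theorem lintegral_sq_mean_sub_le {ι α : Type*} [Fintype ι] [Nonempty ι] [MeasurableSpace α]
    {ν : Measure α} [IsProbabilityMeasure ν] {Y : α → ℝ} (hY : MemLp Y 2 ν) (c : ℝ) :
    ∫⁻ x : ι → α, ENNReal.ofReal (((Fintype.card ι : ℝ)⁻¹ * ∑ i, Y (x i) - c) ^ 2)
        ∂Measure.pi (fun _ => ν)
      ≤ (∫⁻ a, ENNReal.ofReal (Y a ^ 2) ∂ν) / Fintype.card ι
        + ENNReal.ofReal ((∫ a, Y a ∂ν - c) ^ 2) := by
  have hn : (0 : ℝ) < Fintype.card ι := by exact_mod_cast Fintype.card_pos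
  set n : ℝ := (Fintype.card ι : ℝ) with hndef
  have hYi : ∀ i, MemLp (fun x : ι → α => Y (x i)) 2 (Measure.pi fun _ => ν) := fun i =>
    hY.comp_measurePreserving (measurePreserving_eval (fun _ : ι => ν) i)
  have hS : MemLp (∑ i, fun x : ι → α => Y (x i)) 2 (Measure.pi fun _ => ν) :=
    memLp_finsetSum' _ fun i _ => hYi i
  have hS' : (fun x : ι → α => ∑ i, Y (x i)) = ∑ i, fun x : ι → α => Y (x i) := by
    ext x; simp
  have hZ : MemLp (fun x : ι → α => n⁻¹ * ∑ i, Y (x i)) 2 (Measure.pi fun _ => ν) := by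
    have := hS.const_mul n⁻¹
    rw [← hS'] at this
    exact this
  have hW : MemLp (fun x : ι → α => n⁻¹ * ∑ i, Y (x i) - c) 2 (Measure.pi fun _ => ν) :=
    hZ.sub (memLp_const c)
  have hEZ : ∫ x : ι → α, n⁻¹ * ∑ i, Y (x i) ∂Measure.pi (fun _ => ν) = ∫ a, Y a ∂ν := by
    rw [integral_const_mul, integral_finsetSum _ fun i _ => (hYi i).integrable (by norm_num)]
    have : ∀ i, ∫ x : ι → α, Y (x i) ∂Measure.pi (fun _ => ν) = ∫ a, Y a ∂ν := fun i => by
      have h := (measurePreserving_eval (fun _ : ι => ν) i).map_eq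
      have h' := integral_map (μ := Measure.pi fun _ : ι => ν) (φ := Function.eval i) (f := Y)
        (measurable_pi_apply i).aemeasurable (by rw [h]; exact hY.1)
      rw [h] at h'
      exact h'.symm
    simp only [this, Finset.sum_const, Finset.card_univ, nsmul_eq_mul, ← hndef]
    field_simp
  have hVar : Var[fun x : ι → α => n⁻¹ * ∑ i, Y (x i) - c; Measure.pi fun _ => ν]
      = n⁻¹ * Var[Y; ν] := by
    rw [variance_sub_const hZ.1, variance_const_mul, hS', variance_sum_pi fun _ => hY]
    simp only [Finset.sum_const, Finset.card_univ, nsmul_eq_mul, ← hndef]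
    field_simp
  have hsq : ∫ x : ι → α, (n⁻¹ * ∑ i, Y (x i) - c) ^ 2 ∂Measure.pi (fun _ => ν)
      ≤ (∫ a, Y a ^ 2 ∂ν) / n + (∫ a, Y a ∂ν - c) ^ 2 := by
    have h := variance_eq_sub hW
    rw [hVar, integral_sub (hZ.integrable (by norm_num)) (integrable_const c), hEZ] at h
    have h2 := variance_le_expectation_sq hY.1
    have h3 : n⁻¹ * Var[Y; ν] ≤ n⁻¹ * ∫ a, (Y ^ 2) a ∂ν := by gcongr
    simp only [Pi.pow_apply, integral_const, probReal_univ, one_smul] at h h3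
    rw [div_eq_inv_mul]
    linarith
  calc _ = ENNReal.ofReal (∫ x : ι → α, (n⁻¹ * ∑ i, Y (x i) - c) ^ 2 ∂Measure.pi (fun _ => ν)) :=
        (ofReal_integral_eq_lintegral_ofReal hW.integrable_sq
          (Eventually.of_forall fun x => sq_nonneg _)).symm
    _ ≤ ENNReal.ofReal ((∫ a, Y a ^ 2 ∂ν) / n + (∫ a, Y a ∂ν - c) ^ 2) :=
        ENNReal.ofReal_le_ofReal hsq
    _ = _ := by
        rw [ENNReal.ofReal_add (div_nonneg (integral_nonneg fun _ => sq_nonneg _) hn.le)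
          (sq_nonneg _), ENNReal.ofReal_div_of_pos hn,
          ofReal_integral_eq_lintegral_ofReal hY.integrable_sq
            (Eventually.of_forall fun x => sq_nonneg _), hndef, ENNReal.ofReal_natCast]

/-- The bias of a kernel smoother with kernel `κ`: Jensen's inequality for the probability measure
with density `κ (θ₀ - ·)`. -/
lemma ofReal_convolution_sub_sq_le {p : ℕ} {κ G : E p → ℝ} (hκ : Measurable κ)
    (hκ0 : ∀ u, 0 ≤ κ u) (hκ1 : ∫⁻ u, ENNReal.ofReal (κ u) = 1) (hG : Measurable G)
    (hG0 : ∀ θ, 0 ≤ G θ) (θ₀ : E p) (c : ℝ) :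
    ENNReal.ofReal ((∫ θ, κ (θ₀ - θ) ∂(volume.withDensity fun θ => ENNReal.ofReal (G θ)) - c) ^ 2)
      ≤ ∫⁻ θ, ENNReal.ofReal (κ (θ₀ - θ)) * ENNReal.ofReal ((G θ - c) ^ 2) := by
  have hκm : Measurable fun θ => ENNReal.ofReal (κ (θ₀ - θ)) := by fun_prop
  have : IsProbabilityMeasure (volume.withDensity fun θ => ENNReal.ofReal (κ (θ₀ - θ))) := by
    refine ⟨?_⟩
    rw [withDensity_apply _ MeasurableSet.univ, Measure.restrict_univ,
      lintegral_sub_left_eq_self (fun θ => ENNReal.ofReal (κ θ)), hκ1]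
  have h := ofReal_integral_sub_sq_le
    (κ := volume.withDensity fun θ => ENNReal.ofReal (κ (θ₀ - θ))) hG c
  rw [lintegral_withDensity_eq_lintegral_mul _ hκm (by fun_prop)] at h
  have e : ∫ θ, G θ ∂(volume.withDensity fun θ => ENNReal.ofReal (κ (θ₀ - θ)))
      = ∫ θ, κ (θ₀ - θ) ∂(volume.withDensity fun θ => ENNReal.ofReal (G θ)) := by
    rw [integral_withDensity_eq_integral_toReal_smul hκm (by simp),
      integral_withDensity_eq_integral_toReal_smul (by fun_prop) (by simp)]
    refine integral_congr_ae (Eventually.of_forall fun θ => ?_)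
    simp [ENNReal.toReal_ofReal, hκ0, hG0, mul_comm]
  rw [e] at h
  exact h

/-- Mean integrated square error, with respect to a target `g`, of the kernel density estimate
built with the kernel `κ` on an i.i.d. sample of density `G`. -/
theorem lintegral_kernelDensityEstimate_sub_sq_le {p : ℕ} {ι : Type*} [Fintype ι] [Nonempty ι]
    {κ G g : E p → ℝ} (hκ : Measurable κ)
    (hκ0 : ∀ u, 0 ≤ κ u) (hκ1 : ∫⁻ u, ENNReal.ofReal (κ u) = 1)
    (hκ2 : ∫⁻ u, ENNReal.ofReal (κ u ^ 2) ≠ ∞) (hG : Measurable G)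
    (hG0 : ∀ θ, 0 ≤ G θ) (hG1 : ∫⁻ θ, ENNReal.ofReal (G θ) = 1) (hg : Measurable g) :
    ∫⁻ x : ι → E p, (∫⁻ θ₀, ENNReal.ofReal
        (((Fintype.card ι : ℝ)⁻¹ * ∑ i, κ (θ₀ - x i) - g θ₀) ^ 2))
        ∂Measure.pi (fun _ => volume.withDensity fun θ => ENNReal.ofReal (G θ))
      ≤ (∫⁻ u, ENNReal.ofReal (κ u ^ 2)) / Fintype.card ι
        + (2 * (∫⁻ θ, ENNReal.ofReal ((G θ - g θ) ^ 2))
          + 2 * ∫⁻ u, ENNReal.ofReal (κ u) * ∫⁻ θ, ENNReal.ofReal ((g (θ - u) - g θ) ^ 2)) := by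
  set ν : Measure (E p) := volume.withDensity fun θ => ENNReal.ofReal (G θ) with hν
  have hνp : IsProbabilityMeasure ν := by
    refine ⟨?_⟩
    rw [hν, withDensity_apply _ MeasurableSet.univ, Measure.restrict_univ, hG1]
  have hGm : Measurable fun θ => ENNReal.ofReal (G θ) := by fun_prop
  have hjoint : ∫⁻ θ₀, ∫⁻ θ, ENNReal.ofReal (κ (θ₀ - θ) ^ 2) ∂ν
      = ∫⁻ u, ENNReal.ofReal (κ u ^ 2) := by
    rw [lintegral_lintegral_swap (by fun_prop)]
    simp_rw [lintegral_sub_right_eq_self (fun u => ENNReal.ofReal (κ u ^ 2))]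
    simp
  have hfin : ∀ᵐ θ₀ : E p, ∫⁻ θ, ENNReal.ofReal (κ (θ₀ - θ) ^ 2) ∂ν < ∞ := by
    refine ae_lt_top ?_ (by rw [hjoint]; exact hκ2)
    exact Measurable.lintegral_prod_right'
      (f := fun x : E p × E p => ENNReal.ofReal (κ (x.1 - x.2) ^ 2)) (by fun_prop)
  rw [lintegral_lintegral_swap (by fun_prop)]
  have hm1 : Measurable fun θ₀ : E p => ∫⁻ θ, ENNReal.ofReal (κ (θ₀ - θ) ^ 2) ∂ν :=
    Measurable.lintegral_prod_right'
      (f := fun x : E p × E p => ENNReal.ofReal (κ (x.1 - x.2) ^ 2)) (by fun_prop)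
  have hm2 : Measurable fun θ₀ : E p => ∫⁻ θ, ENNReal.ofReal (κ (θ₀ - θ))
      * ENNReal.ofReal ((G θ - g θ) ^ 2) :=
    Measurable.lintegral_prod_right' (f := fun x : E p × E p =>
      ENNReal.ofReal (κ (x.1 - x.2)) * ENNReal.ofReal ((G x.2 - g x.2) ^ 2)) (by fun_prop)
  calc ∫⁻ θ₀, ∫⁻ x : ι → E p, ENNReal.ofReal
        (((Fintype.card ι : ℝ)⁻¹ * ∑ i, κ (θ₀ - x i) - g θ₀) ^ 2) ∂Measure.pi (fun _ => ν)
      ≤ ∫⁻ θ₀, ((∫⁻ θ, ENNReal.ofReal (κ (θ₀ - θ) ^ 2) ∂ν) / Fintype.card ι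
          + (2 * (∫⁻ θ, ENNReal.ofReal (κ (θ₀ - θ)) * ENNReal.ofReal ((G θ - g θ) ^ 2))
            + 2 * ∫⁻ θ, ENNReal.ofReal (κ (θ₀ - θ)) * ENNReal.ofReal ((g θ - g θ₀) ^ 2))) := by
        refine lintegral_mono_ae ?_
        filter_upwards [hfin] with θ₀ h
        refine (lintegral_sq_mean_sub_le (memLp_two_of_lintegral_sq (by fun_prop) h.ne)
          (g θ₀)).trans ?_
        gcongr
        refine (ofReal_convolution_sub_sq_le hκ hκ0 hκ1 hG hG0 θ₀ (g θ₀)).trans ?_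
        rw [← lintegral_const_mul' _ _ (by simp), ← lintegral_const_mul' _ _ (by simp),
          ← lintegral_add_left (by fun_prop)]
        refine lintegral_mono fun θ => ?_
        calc _ ≤ ENNReal.ofReal (κ (θ₀ - θ)) * (2 * ENNReal.ofReal ((G θ - g θ) ^ 2)
              + 2 * ENNReal.ofReal ((g θ - g θ₀) ^ 2)) := by
              gcongr; exact ofReal_sub_sq_le _ _ _
          _ = _ := by ring
    _ = (∫⁻ θ₀, ∫⁻ θ, ENNReal.ofReal (κ (θ₀ - θ) ^ 2) ∂ν) / Fintype.card ι
          + (2 * (∫⁻ θ₀, ∫⁻ θ, ENNReal.ofReal (κ (θ₀ - θ)) * ENNReal.ofReal ((G θ - g θ) ^ 2))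
            + 2 * ∫⁻ θ₀, ∫⁻ θ, ENNReal.ofReal (κ (θ₀ - θ))
                * ENNReal.ofReal ((g θ - g θ₀) ^ 2)) := by
        rw [lintegral_add_left (hm1.div_const _), lintegral_add_left (hm2.const_mul _),
          lintegral_const_mul' _ _ (by simp), lintegral_const_mul' _ _ (by simp)]
        simp_rw [div_eq_mul_inv]
        rw [lintegral_mul_const _ hm1]
    _ = _ := by
        congr 2
        · rw [lintegral_lintegral_swap (by fun_prop)]
          congr 1
          refine lintegral_congr fun θ => ?_
          rw [lintegral_mul_const _ (by fun_prop),
            lintegral_sub_right_eq_self (fun u => ENNReal.ofReal (κ u)), hκ1, one_mul]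
        · congr 1
          have e : ∀ θ₀ : E p, ∫⁻ θ, ENNReal.ofReal (κ (θ₀ - θ))
                * ENNReal.ofReal ((g θ - g θ₀) ^ 2)
              = ∫⁻ u, ENNReal.ofReal (κ u) * ENNReal.ofReal ((g (θ₀ - u) - g θ₀) ^ 2) := by
            intro θ₀
            rw [← lintegral_sub_left_eq_self _ θ₀]
            simp
          simp_rw [e]
          rw [lintegral_lintegral_swap (by fun_prop)]
          exact lintegral_congr fun u => lintegral_const_mul _ (by fun_prop)

/-! ### Rescaled kernels -/

lemma lintegral_rescale {p : ℕ} {h : ℝ} (hh : 0 < h) {F : E p → ℝ≥0∞} (hF : Measurable F) :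
    ∫⁻ u : E p, ENNReal.ofReal (h ^ p)⁻¹ * F (h⁻¹ • u) = ∫⁻ u, F u := by
  have h1 : ∫⁻ u : E p, F (h⁻¹ • u) = ENNReal.ofReal (h ^ p) * ∫⁻ u, F u := by
    rw [← lintegral_map (f := F) (g := fun u : E p => h⁻¹ • u) hF (by fun_prop),
      Measure.map_addHaar_smul volume (inv_ne_zero hh.ne'), lintegral_smul_measure,
      finrank_euclideanSpace_fin, inv_pow, inv_inv, abs_of_pos (by positivity), smul_eq_mul]
  rw [lintegral_const_mul _ (by fun_prop), h1, ← mul_assoc,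
    ← ENNReal.ofReal_mul (by positivity), inv_mul_cancel₀ (by positivity), ENNReal.ofReal_one,
    one_mul]

lemma lintegral_rescaledKernel_mul {p : ℕ} {h : ℝ} (hh : 0 < h) {K : E p → ℝ} (hK : Measurable K)
    {F : E p → ℝ≥0∞} (hF : Measurable F) :
    ∫⁻ u, ENNReal.ofReal ((h ^ p)⁻¹ * K (h⁻¹ • u)) * F u
      = ∫⁻ u, ENNReal.ofReal (K u) * F (h • u) := by
  rw [← lintegral_rescale hh (F := fun u => ENNReal.ofReal (K u) * F (h • u)) (by fun_prop)]
  refine lintegral_congr fun u => ?_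
  rw [ENNReal.ofReal_mul (by positivity), smul_inv_smul₀ hh.ne', mul_assoc]

lemma lintegral_rescaledKernel_sq {p : ℕ} {h : ℝ} (hh : 0 < h) {K : E p → ℝ} (hK : Measurable K) :
    ∫⁻ u, ENNReal.ofReal (((h ^ p)⁻¹ * K (h⁻¹ • u)) ^ 2)
      = ENNReal.ofReal (h ^ p)⁻¹ * ∫⁻ u, ENNReal.ofReal (K u ^ 2) := by
  rw [← lintegral_rescale hh (F := fun u => ENNReal.ofReal (K u ^ 2)) (by fun_prop),
    ← lintegral_const_mul _ (by fun_prop)]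
  refine lintegral_congr fun u => ?_
  rw [← ENNReal.ofReal_mul (by positivity), ← ENNReal.ofReal_mul (by positivity)]
  congr 1; ring

/-! ### Nearest neighbours in an i.i.d. sample -/

section NearestNeighbours

variable {X : Type*}

/-- The event that the points of the sample `x` with index in `A` are exactly those that are
strictly closer than the `i`-th point, closeness being measured by `d`. If `A` has `k` elements
then the `i`-th point is the `(k + 1)`-st nearest one. -/
def nearestEvent {ι : Type*} (d : X → ℝ) (A : Finset ι) (i : ι) : Set (ι → X) :=
  {x | (∀ a ∈ A, d (x a) < d (x i)) ∧ ∀ b ∉ A, d (x i) ≤ d (x b)}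

lemma mem_iff_lt_of_mem_nearestEvent {ι : Type*} {d : X → ℝ} {A : Finset ι} {i : ι} {x : ι → X}
    (hx : x ∈ nearestEvent d A i) (j : ι) : j ∈ A ↔ d (x j) < d (x i) :=
  ⟨hx.1 j, fun h => by_contra fun hj => absurd (hx.2 j hj) (not_le.2 h)⟩

/-- Without ties, the index of the `(k + 1)`-st nearest point is unique. -/
lemma nearestEvent_unique {ι : Type*} [DecidableEq ι] {d : X → ℝ} {A A' : Finset ι} {i i' : ι}
    {x : ι → X} (hinj : Function.Injective fun j => d (x j)) (hcard : A.card = A'.card)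
    (hx : x ∈ nearestEvent d A i) (hx' : x ∈ nearestEvent d A' i') : A = A' ∧ i = i' := by
  have key : ∀ {B B' : Finset ι} {j j' : ι}, B.card = B'.card → x ∈ nearestEvent d B j →
      x ∈ nearestEvent d B' j' → ¬ d (x j) < d (x j') := by
    intro B B' j j' hc h h' hlt
    have hss : B ⊂ B' := by
      refine Finset.ssubset_iff_subset_ne.2 ⟨fun a ha => ?_, ?_⟩
      · exact (mem_iff_lt_of_mem_nearestEvent h' a).2 ((h.1 a ha).trans hlt)
      · rintro rfl
        exact lt_irrefl _ (h.1 j ((mem_iff_lt_of_mem_nearestEvent h' j).2 hlt))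
    exact (Finset.card_lt_card hss).ne hc
  have hii : i = i' :=
    hinj (le_antisymm (not_lt.1 (key hcard.symm hx' hx)) (not_lt.1 (key hcard hx hx')))
  subst hii
  refine ⟨?_, rfl⟩
  ext j
  rw [mem_iff_lt_of_mem_nearestEvent hx, mem_iff_lt_of_mem_nearestEvent hx']

/-- The indices of the first `k` values of `v`, in increasing order. -/
noncomputable def firstIndices {N : ℕ} (k : ℕ) (v : Fin N → ℝ) : Finset (Fin N) :=
  (Finset.univ.filter fun j : Fin N => j.val < k).map (Tuple.sort v).toEmbedding

lemma card_firstIndices {N k : ℕ} (hk : k ≤ N) (v : Fin N → ℝ) : (firstIndices k v).card = k := by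
  rw [firstIndices, Finset.card_map, Fin.card_filter_val_lt, min_eq_right hk]

lemma mem_nearestEvent_firstIndices {N k : ℕ} (hk : k < N) {d : X → ℝ} {x : Fin N → X}
    (hinj : Function.Injective fun j => d (x j)) :
    x ∈ nearestEvent d (firstIndices k fun j => d (x j))
      (Tuple.sort (fun j => d (x j)) ⟨k, hk⟩) := by
  set σ := Tuple.sort fun j => d (x j) with hσ
  have hmono : StrictMono fun j => d (x (σ j)) :=
    (Tuple.monotone_sort fun j => d (x j)).strictMono_of_injective (hinj.comp σ.injective)
  refine ⟨fun a ha => ?_, fun b hb => ?_⟩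
  · obtain ⟨j, hj, rfl⟩ := Finset.mem_map.1 ha
    exact hmono (Fin.lt_def.2 (by simpa using hj))
  · obtain ⟨j, rfl⟩ := σ.surjective b
    refine hmono.monotone (Fin.le_def.2 ?_)
    by_contra hlt
    refine hb (Finset.mem_map.2 ⟨j, ?_, rfl⟩)
    simpa using hlt

variable [MeasurableSpace X]

lemma measurableSet_nearestEvent {ι : Type*} [Countable ι] {d : X → ℝ} (hd : Measurable d)
    (A : Finset ι) (i : ι) : MeasurableSet (nearestEvent d A i) := by
  have h : nearestEvent d A i = (⋂ a ∈ A, {x | d (x a) < d (x i)})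
      ∩ ⋂ b, ⋂ (_ : b ∉ A), {x | d (x i) ≤ d (x b)} := by
    ext x; simp [nearestEvent]
  rw [h]
  refine MeasurableSet.inter (Finset.measurableSet_biInter _ fun a _ => ?_)
    (MeasurableSet.iInter fun b => MeasurableSet.iInter fun _ => ?_)
  · exact measurableSet_lt (by fun_prop) (by fun_prop)
  · exact measurableSet_le (by fun_prop) (by fun_prop)

variable {ρ : Measure X} [IsProbabilityMeasure ρ]

/-- A sample from a law without ties is almost surely without ties. -/
lemma ae_injective_pi {ι : Type*} [Fintype ι] {d : X → ℝ} (hd : Measurable d)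
    (hatom : ∀ r, ρ {w | d w = r} = 0) :
    ∀ᵐ x ∂Measure.pi (fun _ : ι => ρ), Function.Injective fun j => d (x j) := by
  have hpair : ∀ i j : ι, i ≠ j →
      ∀ᵐ x ∂Measure.pi (fun _ : ι => ρ), d (x i) ≠ d (x j) := by
    intro i j hij
    have hind : IndepFun (fun x : ι → X => x i) (fun x => x j) (Measure.pi fun _ => ρ) :=
      (iIndepFun_pi (μ := fun _ : ι => ρ) (X := fun _ => (id : X → X))
        fun _ => aemeasurable_id).indepFun hij
    rw [indepFun_iff_map_prod_eq_prod_map_map (measurable_pi_apply i).aemeasurable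
      (measurable_pi_apply j).aemeasurable] at hind
    have hm : ∀ i : ι, (Measure.pi fun _ : ι => ρ).map (fun x => x i) = ρ :=
      fun i => (measurePreserving_eval (fun _ : ι => ρ) i).map_eq
    rw [hm, hm] at hind
    have hS : MeasurableSet {w : X × X | d w.1 = d w.2} :=
      measurableSet_eq_fun (by fun_prop) (by fun_prop)
    have h0 : (ρ.prod ρ) {w : X × X | d w.1 = d w.2} = 0 := by
      rw [Measure.measure_prod_null hS]
      refine Eventually.of_forall fun u => ?_
      have : Prod.mk u ⁻¹' {w : X × X | d w.1 = d w.2} = {w | d w = d u} := by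
        ext w; simp [eq_comm]
      simpa [this] using hatom (d u)
    rw [← hind, Measure.map_apply (by fun_prop) hS] at h0
    exact measure_eq_zero_iff_ae_notMem.1 h0
  have hall : ∀ᵐ x ∂Measure.pi (fun _ : ι => ρ), ∀ i j, i ≠ j → d (x i) ≠ d (x j) := by
    simp_rw [ae_all_iff]
    exact hpair
  filter_upwards [hall] with x hx i j hij
  by_contra hne
  exact hx i j hne hij

/-- A product of copies of `ρ` restricted to `B` is a multiple of the law of an i.i.d. sample from
the conditional law `ρ[|B]`. -/
lemma pi_restrict_eq_smul_pi_cond {ι : Type*} [Fintype ι] {B : Set X} (hB : MeasurableSet B)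
    (h0 : ρ B ≠ 0) :
    Measure.pi (fun _ : ι => ρ.restrict B)
      = ρ B ^ Fintype.card ι • Measure.pi fun _ : ι => ρ[|B] := by
  have := cond_isProbabilityMeasure h0
  refine Measure.pi_eq fun s hs => ?_
  rw [Measure.smul_apply, Measure.pi_pi, smul_eq_mul, ← Finset.card_univ, ← Finset.prod_const,
    ← Finset.prod_mul_distrib]
  refine Finset.prod_congr rfl fun i _ => ?_
  rw [cond_apply hB, Measure.restrict_apply (hs i), ← mul_assoc,
    ENNReal.mul_inv_cancel h0 (measure_ne_top _ _), one_mul, Set.inter_comm]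

lemma setLIntegral_pi_le_of_cond {ι : Type*} [Fintype ι] [Nonempty ι] {B : Set X}
    (hB : MeasurableSet B) {H : (ι → X) → ℝ≥0∞} {R : ℝ≥0∞}
    (h : ρ B ≠ 0 → ∫⁻ x, H x ∂Measure.pi (fun _ => ρ[|B]) ≤ R) :
    ∫⁻ x in {x | ∀ i, x i ∈ B}, H x ∂Measure.pi (fun _ : ι => ρ)
      ≤ ∫⁻ _ in {x | ∀ i, x i ∈ B}, R ∂Measure.pi (fun _ : ι => ρ) := by
  have hset : {x : ι → X | ∀ i, x i ∈ B} = Set.univ.pi fun _ => B := by ext; simp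
  rw [hset]
  by_cases h0 : ρ B = 0
  · rw [setLIntegral_measure_zero]
    · exact zero_le
    · simp [Measure.pi_pi, h0]
  · rw [setLIntegral_const, Measure.restrict_pi_pi, pi_restrict_eq_smul_pi_cond hB h0,
      lintegral_smul_measure, Measure.pi_pi, smul_eq_mul, Finset.prod_const, Finset.card_univ,
      mul_comm R]
    gcongr
    exact h h0

/-- Conditionally on the position of the `i`-th point, and on `A` being the set of the points that
are nearer, the points with index in `A` are i.i.d. with law `ρ` conditioned on a ball. -/
lemma setLIntegral_nearestEvent_le {ι : Type*} [Fintype ι] [DecidableEq ι] {d : X → ℝ}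
    (hd : Measurable d) {A : Finset ι} (hA : A.Nonempty) {i : ι} (hi : i ∉ A)
    {H : (A → X) → ℝ≥0∞} (hH : Measurable H) {R : ℝ → ℝ≥0∞} (hR : Measurable R)
    (h : ∀ r, ρ {w | d w < r} ≠ 0 → ∫⁻ x, H x ∂Measure.pi (fun _ => ρ[|{w | d w < r}]) ≤ R r) :
    ∫⁻ x in nearestEvent d A i, H (fun a => x a) ∂Measure.pi (fun _ : ι => ρ)
      ≤ ∫⁻ x in nearestEvent d A i, R (d (x i)) ∂Measure.pi (fun _ : ι => ρ) := by
  have : Nonempty A := hA.to_subtype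
  set Ev := nearestEvent d A i with hEv
  have hEvm : MeasurableSet Ev := measurableSet_nearestEvent hd A i
  let e := MeasurableEquiv.piEquivPiSubtypeProd (fun _ : ι => X) (· ∈ A)
  have hmp : MeasurePreserving e (Measure.pi fun _ : ι => ρ)
      ((Measure.pi fun _ : {a // a ∈ A} => ρ).prod (Measure.pi fun _ : {b // b ∉ A} => ρ)) := by
    convert measurePreserving_piEquivPiSubtypeProd (fun _ : ι => ρ) (· ∈ A)
  -- The event and the two integrands, in terms of the coordinates in `A` and outside `A`.
  have hsplit : ∀ F : ({a // a ∈ A} → X) × ({b // b ∉ A} → X) → ℝ≥0∞, Measurable F →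
      ∫⁻ x in Ev, F (e x) ∂Measure.pi (fun _ : ι => ρ)
        = ∫⁻ y, ∫⁻ z in {z | ∀ a, z a ∈ {w | d w < d (y ⟨i, hi⟩)}},
            {y : {b // b ∉ A} → X | ∀ b, d (y ⟨i, hi⟩) ≤ d (y b)}.indicator (fun y => F (z, y)) y
            ∂Measure.pi (fun _ : {a // a ∈ A} => ρ) ∂Measure.pi (fun _ : {b // b ∉ A} => ρ) := by
    intro F hF
    have hE' : MeasurableSet (e.symm ⁻¹' Ev) := e.symm.measurable hEvm
    have h1 : ∫⁻ x in Ev, F (e x) ∂Measure.pi (fun _ : ι => ρ)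
        = ∫⁻ w, (e.symm ⁻¹' Ev).indicator F w ∂((Measure.pi fun _ : {a // a ∈ A} => ρ).prod
            (Measure.pi fun _ : {b // b ∉ A} => ρ)) := by
      rw [← hmp.lintegral_comp (hF.indicator hE'), ← lintegral_indicator hEvm]
      refine lintegral_congr fun x => ?_
      by_cases hx : x ∈ Ev
      · rw [Set.indicator_of_mem hx, Set.indicator_of_mem (by simpa using hx)]
      · rw [Set.indicator_of_notMem hx, Set.indicator_of_notMem (by simpa using hx)]
    rw [h1, lintegral_prod_symm _ (hF.indicator hE').aemeasurable]
    refine lintegral_congr fun y => ?_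
    have hBm : MeasurableSet {z : {a // a ∈ A} → X | ∀ a, z a ∈ {w | d w < d (y ⟨i, hi⟩)}} := by
      have : {z : {a // a ∈ A} → X | ∀ a, z a ∈ {w | d w < d (y ⟨i, hi⟩)}}
          = ⋂ a, {z | d (z a) < d (y ⟨i, hi⟩)} := by ext; simp
      rw [this]
      exact MeasurableSet.iInter fun a => measurableSet_lt (by fun_prop) (by fun_prop)
    rw [← lintegral_indicator hBm]
    refine lintegral_congr fun z => ?_
    have hmem : (z, y) ∈ e.symm ⁻¹' Ev ↔
        (∀ a, z a ∈ {w | d w < d (y ⟨i, hi⟩)}) ∧ ∀ b, d (y ⟨i, hi⟩) ≤ d (y b) := by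
      obtain ⟨x, hx⟩ := e.surjective (z, y)
      have hz : z = fun a => x a.1 := (congrArg Prod.fst hx).symm
      have hy : y = fun b => x b.1 := (congrArg Prod.snd hx).symm
      rw [Set.mem_preimage, ← hx, e.symm_apply_apply, hz, hy]
      simp [hEv, nearestEvent]
    by_cases h1 : z ∈ {z : {a // a ∈ A} → X | ∀ a, z a ∈ {w | d w < d (y ⟨i, hi⟩)}}
    · refine Eq.trans ?_ (Set.indicator_of_mem h1 _).symm
      by_cases h2 : y ∈ {y : {b // b ∉ A} → X | ∀ b, d (y ⟨i, hi⟩) ≤ d (y b)}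
      · exact (Set.indicator_of_mem (hmem.2 ⟨h1, h2⟩) _).trans
          (Set.indicator_of_mem h2 fun y => F (z, y)).symm
      · exact (Set.indicator_of_notMem (fun h => h2 (hmem.1 h).2) _).trans
          (Set.indicator_of_notMem h2 fun y => F (z, y)).symm
    · exact (Set.indicator_of_notMem (fun h => h1 (hmem.1 h).1) _).trans
        (Set.indicator_of_notMem h1 _).symm
  have hL := hsplit (fun w => H w.1) (by fun_prop)
  have hRt := hsplit (fun w => R (d (w.2 ⟨i, hi⟩))) (by fun_prop)
  refine hL.trans_le (le_trans ?_ hRt.ge)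
  refine lintegral_mono fun y => ?_
  by_cases hy : y ∈ {y : {b // b ∉ A} → X | ∀ b, d (y ⟨i, hi⟩) ≤ d (y b)}
  · simp only [Set.indicator_of_mem hy]
    exact setLIntegral_pi_le_of_cond (measurableSet_lt hd measurable_const) (h _)
  · simp only [Set.indicator_of_notMem hy, le_refl]

/-- A functional `Ψ` of the `k` nearest points is controlled in mean by bounds valid for i.i.d.
samples from `ρ` conditioned on balls: `a` for balls of radius less than `δ`, `b` for the others.
The second bound only enters when at most `k` points of the sample are at distance less than
`δ`. -/
theorem lintegral_nearest_le {N k : ℕ} (hk : 1 ≤ k) (hkN : k < N) {d : X → ℝ} (hd : Measurable d)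
    (hatom : ∀ r, ρ {w | d w = r} = 0)
    {H : ∀ A : Finset (Fin N), (A → X) → ℝ≥0∞} (hH : ∀ A, Measurable (H A))
    {a b : ℝ≥0∞} {δ : ℝ}
    (hcond : ∀ A : Finset (Fin N), A.card = k → ∀ r, ρ {w | d w < r} ≠ 0 →
      ∫⁻ x, H A x ∂Measure.pi (fun _ => ρ[|{w | d w < r}]) ≤ if r < δ then a else b)
    {Ω : Type*} [MeasurableSpace Ω] {P : Measure Ω} {Z : Ω → Fin N → X}
    (hZ : MeasurePreserving Z P (Measure.pi fun _ => ρ)) {Ψ : (Fin N → X) → ℝ≥0∞}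
    (hΨ : ∀ x, Ψ x ≤ H (firstIndices k fun j => d (x j)) fun j => x j) :
    ∫⁻ ω, Ψ (Z ω) ∂P
      ≤ a + b * Measure.pi (fun _ : Fin N => ρ)
        {x | (Finset.univ.filter fun j => d (x j) < δ).card ≤ k} := by
  classical
  set R : ℝ → ℝ≥0∞ := fun r => if r < δ then a else b with hRdef
  have hR : Measurable R := Measurable.ite measurableSet_Iio measurable_const measurable_const
  set T : Finset (Finset (Fin N) × Fin N) :=
    Finset.univ.filter fun t => t.1.card = k ∧ t.2 ∉ t.1 with hT
  have hEvm : ∀ t : Finset (Fin N) × Fin N, MeasurableSet (nearestEvent (X := X) d t.1 t.2) :=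
    fun t => measurableSet_nearestEvent hd _ _
  have hinj := ae_injective_pi (ι := Fin N) hd hatom
  have hmem : ∀ x : Fin N → X, Function.Injective (fun j => d (x j)) →
      ((firstIndices k fun j => d (x j), Tuple.sort (fun j => d (x j)) ⟨k, hkN⟩) :
        Finset (Fin N) × Fin N) ∈ T := by
    intro x hx
    refine Finset.mem_filter.2 ⟨Finset.mem_univ _, card_firstIndices hkN.le _, fun hi => ?_⟩
    exact lt_irrefl _ ((mem_nearestEvent_firstIndices hkN hx).1 _ hi)
  have hHm : ∀ t ∈ T, Measurable
      ((nearestEvent d t.1 t.2).indicator fun x : Fin N → X => H t.1 fun j => x j) :=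
    fun t _ => ((hH t.1).comp (by fun_prop)).indicator (hEvm t)
  -- `Ψ` need not be measurable, so it is bounded before the law of the sample is used.
  calc ∫⁻ ω, Ψ (Z ω) ∂P
      ≤ ∫⁻ ω, ∑ t ∈ T, (nearestEvent d t.1 t.2).indicator (fun x => H t.1 fun j => x j) (Z ω)
          ∂P := by
        refine lintegral_mono_ae ?_
        filter_upwards [hZ.quasiMeasurePreserving.ae hinj] with ω hx
        refine le_trans ?_ (Finset.single_le_sum (fun _ _ => zero_le) (hmem (Z ω) hx))
        rw [Set.indicator_of_mem (mem_nearestEvent_firstIndices hkN hx)]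
        exact hΨ (Z ω)
    _ = ∫⁻ x, ∑ t ∈ T, (nearestEvent d t.1 t.2).indicator (fun x => H t.1 fun j => x j) x
          ∂Measure.pi (fun _ => ρ) := by
        exact hZ.lintegral_comp (Finset.measurable_fun_sum T hHm)
    _ = ∑ t ∈ T, ∫⁻ x in nearestEvent d t.1 t.2, H t.1 (fun j => x j)
          ∂Measure.pi (fun _ => ρ) := by
        rw [lintegral_finsetSum]
        · exact Finset.sum_congr rfl fun t _ => lintegral_indicator (hEvm t) _
        · exact hHm
    _ ≤ ∑ t ∈ T, ∫⁻ x in nearestEvent d t.1 t.2, R (d (x t.2)) ∂Measure.pi (fun _ => ρ) := by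
        refine Finset.sum_le_sum fun t ht => ?_
        obtain ⟨-, hcard, hi⟩ := Finset.mem_filter.1 ht
        exact setLIntegral_nearestEvent_le hd (Finset.card_pos.1 (by omega)) hi (hH t.1) hR
          (hcond t.1 hcard)
    _ = ∫⁻ x, ∑ t ∈ T, (nearestEvent d t.1 t.2).indicator (fun x => R (d (x t.2))) x
          ∂Measure.pi (fun _ => ρ) := by
        rw [lintegral_finsetSum]
        · exact Finset.sum_congr rfl fun t _ => (lintegral_indicator (hEvm t) _).symm
        · exact fun t _ => (hR.comp (by fun_prop)).indicator (hEvm t)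
    _ ≤ ∫⁻ x, a + {x | (Finset.univ.filter fun j => d (x j) < δ).card ≤ k}.indicator
          (fun _ => b) x ∂Measure.pi (fun _ => ρ) := by
        refine lintegral_mono_ae ?_
        filter_upwards [hinj] with x hx
        have hx0 := mem_nearestEvent_firstIndices hkN hx
        rw [Finset.sum_eq_single_of_mem _ (hmem x hx), Set.indicator_of_mem hx0]
        · simp only [hRdef]
          split_ifs with hδ
          · exact le_self_add
          · refine le_trans ?_ le_add_self
            rw [Set.indicator_of_mem]
            refine (Finset.card_le_card fun j hj => ?_).trans_eq
              (card_firstIndices hkN.le fun j => d (x j))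
            rw [mem_iff_lt_of_mem_nearestEvent hx0]
            exact (Finset.mem_filter.1 hj).2.trans_le (not_lt.1 hδ)
        · rintro ⟨A, i⟩ ht hne
          refine Set.indicator_of_notMem (fun hxt => hne ?_) _
          obtain ⟨h1, h2⟩ := nearestEvent_unique hx
            ((Finset.mem_filter.1 ht).2.1.trans (card_firstIndices hkN.le _).symm) hxt hx0
          exact Prod.ext h1 h2
    _ ≤ _ := by
        rw [lintegral_add_left measurable_const]
        gcongr
        · simp
        · exact (lintegral_indicator_const_le _ _)

/-- If a fixed proportion of the points is expected in `B`, then it is unlikely that a vanishing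
proportion is found there. -/
theorem tendsto_measure_card_le {B : Set X} (hB : MeasurableSet B) (h0 : ρ B ≠ 0) {k : ℕ → ℕ}
    (hk : Tendsto (fun N => (k N : ℝ) / (N : ℝ)) atTop (𝓝 0)) [DecidablePred (· ∈ B)] :
    Tendsto (fun N => Measure.pi (fun _ : Fin N => ρ)
      {x | (Finset.univ.filter fun j => x j ∈ B).card ≤ k N}) atTop (𝓝 0) := by
  set q : ℝ := ρ.real B with hq
  have hq0 : 0 < q := ENNReal.toReal_pos h0 (measure_ne_top _ _)
  set Y : X → ℝ := B.indicator fun _ => 1 with hY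
  have hYL : MemLp Y 2 ρ := memLp_indicator_const 2 hB 1 (Or.inr (measure_ne_top _ _))
  have hYm : Measurable Y := measurable_const.indicator hB
  have hEY : ∫ w, Y w ∂ρ = q := by
    rw [hY, integral_indicator_const _ hB]; simp [hq]
  have hY2 : ∫⁻ w, ENNReal.ofReal (Y w ^ 2) ∂ρ ≤ 1 := by
    calc _ ≤ ∫⁻ _, 1 ∂ρ := lintegral_mono fun w => by
          rw [hY]
          by_cases hw : w ∈ B <;> simp [hw]
      _ = 1 := by simp
  have hc : ENNReal.ofReal ((q / 2) ^ 2) ≠ 0 := by simpa using by positivity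
  have hlim : Tendsto (fun N : ℕ => (ENNReal.ofReal ((q / 2) ^ 2))⁻¹ * (N : ℝ≥0∞)⁻¹)
      atTop (𝓝 0) := by
    simpa using ENNReal.Tendsto.const_mul ENNReal.tendsto_inv_nat_nhds_zero
      (Or.inr (ENNReal.inv_ne_top.2 hc))
  refine tendsto_of_tendsto_of_tendsto_of_le_of_le' tendsto_const_nhds hlim
    (Eventually.of_forall fun _ => zero_le) ?_
  filter_upwards [(tendsto_order.1 hk).2 (q / 2) (by positivity), eventually_ge_atTop 1]
    with N hkN hN
  have : Nonempty (Fin N) := ⟨⟨0, hN⟩⟩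
  have hb := lintegral_sq_mean_sub_le (ι := Fin N) hYL q
  rw [hEY, sub_self, Fintype.card_fin] at hb
  have hmark := mul_meas_ge_le_lintegral (μ := Measure.pi fun _ : Fin N => ρ)
    (f := fun x => ENNReal.ofReal (((N : ℝ)⁻¹ * ∑ i, Y (x i) - q) ^ 2)) (by fun_prop)
    (ENNReal.ofReal ((q / 2) ^ 2))
  have hsub : {x : Fin N → X | (Finset.univ.filter fun j => x j ∈ B).card ≤ k N}
      ⊆ {x | ENNReal.ofReal ((q / 2) ^ 2)
          ≤ ENNReal.ofReal (((N : ℝ)⁻¹ * ∑ i, Y (x i) - q) ^ 2)} := by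
    intro x hx
    have hsum : ∑ i, Y (x i) = ((Finset.univ.filter fun j => x j ∈ B).card : ℝ) := by
      simp [hY, Set.indicator_apply]
    have h1 : (N : ℝ)⁻¹ * ∑ i, Y (x i) ≤ q / 2 := by
      rw [hsum, ← div_eq_inv_mul]
      refine le_trans ?_ hkN.le
      gcongr
      exact_mod_cast hx
    exact ENNReal.ofReal_le_ofReal (by nlinarith)
  calc _ ≤ Measure.pi (fun _ : Fin N => ρ) {x | ENNReal.ofReal ((q / 2) ^ 2)
          ≤ ENNReal.ofReal (((N : ℝ)⁻¹ * ∑ i, Y (x i) - q) ^ 2)} := measure_mono hsub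
    _ ≤ (ENNReal.ofReal ((q / 2) ^ 2))⁻¹ * (N : ℝ≥0∞)⁻¹ := by
        rw [← ENNReal.div_eq_inv_mul, ENNReal.le_div_iff_mul_le (Or.inl hc) (by simp), mul_comm]
        refine hmark.trans (hb.trans ?_)
        simp only [ne_eq, OfNat.ofNat_ne_zero, not_false_eq_true, zero_pow, ENNReal.ofReal_zero,
          add_zero]
        calc _ ≤ 1 / (N : ℝ≥0∞) := by gcongr
          _ = _ := one_div _

end NearestNeighbours

/-! ### The density of the parameter when the statistic falls in a ball -/

section BallDensity

variable {p m : ℕ} {f : E p × E m → ℝ}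

/-- `∫ f (θ, s) ds` over the open ball of radius `r` around `s₀`, with values in `[0, ∞]`. -/
noncomputable def ballMass (f : E p × E m → ℝ) (s₀ : E m) (r : ℝ) (θ : E p) : ℝ≥0∞ :=
  ∫⁻ s in Metric.ball s₀ r, ENNReal.ofReal (f (θ, s))

/-- The conditional density of the parameter when `(θ, s)` has density `f` and `s` is known to lie
in the open ball of radius `r` around `s₀`. It is real-valued; where `ballMass` is infinite, on a
null set, its value is `0`. -/
noncomputable def ballDensity (f : E p × E m → ℝ) (s₀ : E m) (r : ℝ) (θ : E p) : ℝ :=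
  (ballMass f s₀ r θ / ∫⁻ θ', ballMass f s₀ r θ').toReal

lemma measurable_ballMass (hf : Measurable f) (s₀ : E m) (r : ℝ) :
    Measurable (ballMass f s₀ r) :=
  Measurable.lintegral_prod_right' (f := fun x => ENNReal.ofReal (f x)) (by fun_prop)

lemma measurable_ballDensity (hf : Measurable f) (s₀ : E m) (r : ℝ) :
    Measurable (ballDensity f s₀ r) :=
  ((measurable_ballMass hf s₀ r).div_const _).ennreal_toReal

lemma setOf_norm_sub_lt_eq (s₀ : E m) (r : ℝ) :
    {w : E p × E m | ‖w.2 - s₀‖ < r} = Set.univ ×ˢ Metric.ball s₀ r := by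
  ext w; simp [dist_eq_norm]

lemma withDensity_prod_ball (hf : Measurable f) {A : Set (E p)} (hA : MeasurableSet A)
    (s₀ : E m) (r : ℝ) :
    (volume.withDensity fun x => ENNReal.ofReal (f x)) (A ×ˢ Metric.ball s₀ r)
      = ∫⁻ θ in A, ballMass f s₀ r θ := by
  rw [withDensity_apply _ (hA.prod Metric.isOpen_ball.measurableSet), Measure.volume_eq_prod,
    ← Measure.prod_restrict, lintegral_prod _ (by fun_prop)]
  rfl

lemma withDensity_ball (hf : Measurable f) (s₀ : E m) (r : ℝ) :
    (volume.withDensity fun x => ENNReal.ofReal (f x)) {w | ‖w.2 - s₀‖ < r}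
      = ∫⁻ θ, ballMass f s₀ r θ := by
  rw [setOf_norm_sub_lt_eq, withDensity_prod_ball hf MeasurableSet.univ, Measure.restrict_univ]

lemma lintegral_ballMass_le (hf : Measurable f) (s₀ : E m) (r : ℝ) :
    ∫⁻ θ, ballMass f s₀ r θ ≤ ∫⁻ x, ENNReal.ofReal (f x) := by
  rw [← withDensity_ball hf]
  refine (measure_mono (Set.subset_univ _)).trans_eq ?_
  rw [withDensity_apply _ MeasurableSet.univ, Measure.restrict_univ]

lemma lintegral_ballMass_eq (hf : Measurable f) (s₀ : E m) (r : ℝ) :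
    ∫⁻ θ, ballMass f s₀ r θ
      = ∫⁻ s in Metric.ball s₀ r, ∫⁻ θ, ENNReal.ofReal (f (θ, s)) := by
  unfold ballMass
  exact lintegral_lintegral_swap (by fun_prop)

lemma ae_ballMass_lt_top (hf : Measurable f) (hf1 : ∫⁻ x, ENNReal.ofReal (f x) ≠ ∞)
    (s₀ : E m) (r : ℝ) : ∀ᵐ θ, ballMass f s₀ r θ < ∞ :=
  ae_lt_top (measurable_ballMass hf s₀ r)
    ((lintegral_ballMass_le hf s₀ r).trans_lt hf1.lt_top).ne

lemma ae_ofReal_ballDensity (hf : Measurable f) (hf1 : ∫⁻ x, ENNReal.ofReal (f x) ≠ ∞)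
    {s₀ : E m} {r : ℝ} (h0 : ∫⁻ θ, ballMass f s₀ r θ ≠ 0) :
    (fun θ => ENNReal.ofReal (ballDensity f s₀ r θ))
      =ᵐ[volume] fun θ => ballMass f s₀ r θ / ∫⁻ θ', ballMass f s₀ r θ' := by
  filter_upwards [ae_ballMass_lt_top hf hf1 s₀ r] with θ hθ
  exact ENNReal.ofReal_toReal (ENNReal.div_lt_top hθ.ne h0).ne

lemma lintegral_ofReal_ballDensity (hf : Measurable f) (hf1 : ∫⁻ x, ENNReal.ofReal (f x) ≠ ∞)
    {s₀ : E m} {r : ℝ} (h0 : ∫⁻ θ, ballMass f s₀ r θ ≠ 0) :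
    ∫⁻ θ, ENNReal.ofReal (ballDensity f s₀ r θ) = 1 := by
  rw [lintegral_congr_ae (ae_ofReal_ballDensity hf hf1 h0)]
  simp_rw [div_eq_mul_inv]
  rw [lintegral_mul_const _ (measurable_ballMass hf s₀ r),
    ENNReal.mul_inv_cancel h0 ((lintegral_ballMass_le hf s₀ r).trans_lt hf1.lt_top).ne]

lemma map_fst_cond_ball (hf : Measurable f) (hf1 : ∫⁻ x, ENNReal.ofReal (f x) ≠ ∞)
    {s₀ : E m} {r : ℝ} (h0 : ∫⁻ θ, ballMass f s₀ r θ ≠ 0) :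
    ((volume.withDensity fun x => ENNReal.ofReal (f x))[|{w | ‖w.2 - s₀‖ < r}]).map Prod.fst
      = volume.withDensity fun θ => ENNReal.ofReal (ballDensity f s₀ r θ) := by
  rw [withDensity_congr_ae (ae_ofReal_ballDensity hf hf1 h0)]
  ext A hA
  rw [Measure.map_apply measurable_fst hA,
    cond_apply (measurableSet_lt (by fun_prop) measurable_const), withDensity_ball hf,
    withDensity_apply _ hA]
  have : {w : E p × E m | ‖w.2 - s₀‖ < r} ∩ Prod.fst ⁻¹' A = A ×ˢ Metric.ball s₀ r := by
    ext w; simp [dist_eq_norm, and_comm]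
  rw [this, withDensity_prod_ball hf hA]
  simp_rw [div_eq_mul_inv]
  rw [lintegral_mul_const _ (measurable_ballMass hf s₀ r), mul_comm]

/-- The distance in `L²` between the density given a ball and the density given its centre, in
terms of the mean oscillation of the sections of `f` and of the mean `a` of the marginal density
over the ball. -/
lemma lintegral_ballDensity_sub_sq_le (hf : Measurable f) (hf0 : ∀ x, 0 ≤ f x)
    (s₀ : E m) {r : ℝ} (hr : 0 < r)
    {a : ℝ} (ha : a = ((∫⁻ θ, ballMass f s₀ r θ) / volume (Metric.ball s₀ r)).toReal) (b : ℝ) :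
    ∫⁻ θ, ENNReal.ofReal ((ballDensity f s₀ r θ - f (θ, s₀) / b) ^ 2)
      ≤ 2 * (ENNReal.ofReal ((a⁻¹) ^ 2)
          * ((∫⁻ s in Metric.ball s₀ r, ∫⁻ θ, ENNReal.ofReal ((f (θ, s) - f (θ, s₀)) ^ 2))
            / volume (Metric.ball s₀ r)))
        + 2 * (ENNReal.ofReal ((a⁻¹ - b⁻¹) ^ 2) * ∫⁻ θ, ENNReal.ofReal (f (θ, s₀) ^ 2)) := by
  have hV0 : volume (Metric.ball s₀ r) ≠ 0 := (Metric.measure_ball_pos volume s₀ hr).ne'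
  have hVt : volume (Metric.ball s₀ r) ≠ ∞ := measure_ball_lt_top.ne
  have : IsProbabilityMeasure ((volume : Measure (E m))[|Metric.ball s₀ r]) :=
    cond_isProbabilityMeasure_of_finite hV0 hVt
  set κ := (volume : Measure (E m))[|Metric.ball s₀ r] with hκ
  have hκint : ∀ F : E m → ℝ≥0∞, ∫⁻ s, F s ∂κ
      = (∫⁻ s in Metric.ball s₀ r, F s) / volume (Metric.ball s₀ r) := by
    intro F
    rw [hκ, ProbabilityTheory.cond, lintegral_smul_measure, smul_eq_mul,
      ENNReal.div_eq_inv_mul]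
  have hG : ∀ θ, ballDensity f s₀ r θ = a⁻¹ * ∫ s, f (θ, s) ∂κ := by
    intro θ
    have hs : Measurable fun s => f (θ, s) := by fun_prop
    rw [integral_eq_lintegral_of_nonneg_ae (Eventually.of_forall fun s => hf0 _)
      hs.aestronglyMeasurable, hκint, ha, ballDensity, ENNReal.toReal_div, ENNReal.toReal_div,
      ENNReal.toReal_div, ballMass]
    have : (volume (Metric.ball s₀ r)).toReal ≠ 0 := ENNReal.toReal_ne_zero.2 ⟨hV0, hVt⟩
    rw [inv_div, div_mul_div_comm, mul_comm, mul_div_mul_right _ _ this]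
  have hm : Measurable fun θ => ∫⁻ s, ENNReal.ofReal ((f (θ, s) - f (θ, s₀)) ^ 2) ∂κ :=
    Measurable.lintegral_prod_right'
      (f := fun x : E p × E m => ENNReal.ofReal ((f x - f (x.1, s₀)) ^ 2)) (by fun_prop)
  have hpt : ∀ θ, ENNReal.ofReal ((ballDensity f s₀ r θ - f (θ, s₀) / b) ^ 2)
      ≤ 2 * (ENNReal.ofReal ((a⁻¹) ^ 2)
          * ∫⁻ s, ENNReal.ofReal ((f (θ, s) - f (θ, s₀)) ^ 2) ∂κ)
        + 2 * (ENNReal.ofReal ((a⁻¹ - b⁻¹) ^ 2) * ENNReal.ofReal (f (θ, s₀) ^ 2)) := by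
    intro θ
    refine (ofReal_sub_sq_le _ _ (a⁻¹ * f (θ, s₀))).trans ?_
    gcongr
    · calc _ = ENNReal.ofReal ((a⁻¹) ^ 2)
            * ENNReal.ofReal ((∫ s, f (θ, s) ∂κ - f (θ, s₀)) ^ 2) := by
            rw [← ENNReal.ofReal_mul (sq_nonneg _), hG]
            congr 1; ring
        _ ≤ _ := by
            gcongr
            exact ofReal_integral_sub_sq_le (by fun_prop) _
    · rw [← ENNReal.ofReal_mul (sq_nonneg _)]
      refine le_of_eq ?_
      congr 1; rw [div_eq_mul_inv]; ring
  calc _ ≤ _ := lintegral_mono hpt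
    _ = _ := by
      rw [lintegral_add_left ((hm.const_mul _).const_mul _), lintegral_const_mul' _ _ (by simp),
        lintegral_const_mul' _ _ (by simp), lintegral_const_mul' _ _ (by simp),
        lintegral_const_mul' _ _ (by simp), ← hκint]
      congr 3
      exact lintegral_lintegral_swap (by fun_prop)

/-- For almost every `s₀` of positive marginal density, the density of the parameter given that the
statistic lies in a ball around `s₀` converges in `L²` to the posterior density at `s₀`. -/
theorem ae_tendsto_lintegral_ballDensity_sub_sq (hf : Measurable f) (hf0 : ∀ x, 0 ≤ f x)
    (hf1 : ∫⁻ x, ENNReal.ofReal (f x) ≠ ∞) (hf2 : ∫⁻ x, ENNReal.ofReal (f x ^ 2) ≠ ∞) :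
    ∀ᵐ s₀ : E m, 0 < ∫ θ, f (θ, s₀) →
      ∫⁻ θ, ENNReal.ofReal (f (θ, s₀) ^ 2) ≠ ∞ ∧ (∀ r, 0 < r → ∫⁻ θ, ballMass f s₀ r θ ≠ 0) ∧
      Tendsto (fun r => ∫⁻ θ, ENNReal.ofReal
        ((ballDensity f s₀ r θ - f (θ, s₀) / ∫ θ', f (θ', s₀)) ^ 2)) (𝓝[>] 0) (𝓝 0) := by
  have hm1 : Measurable fun s => ∫⁻ θ, ENNReal.ofReal (f (θ, s)) :=
    Measurable.lintegral_prod_left' (f := fun x => ENNReal.ofReal (f x)) (by fun_prop)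
  have hm2 : Measurable fun s => ∫⁻ θ, ENNReal.ofReal (f (θ, s) ^ 2) :=
    Measurable.lintegral_prod_left' (f := fun x => ENNReal.ofReal (f x ^ 2)) (by fun_prop)
  have hF1 : ∫⁻ s, ∫⁻ θ, ENNReal.ofReal (f (θ, s)) ≠ ∞ := by
    rw [← lintegral_prod_symm' (fun x => ENNReal.ofReal (f x)) (by fun_prop)]
    exact hf1
  have hF2 : ∫⁻ s, ∫⁻ θ, ENNReal.ofReal (f (θ, s) ^ 2) ≠ ∞ := by
    rw [← lintegral_prod_symm' (fun x => ENNReal.ofReal (f x ^ 2)) (by fun_prop)]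
    exact hf2
  filter_upwards [ae_tendsto_average_sq_dist_section hf hf2,
    ae_tendsto_lintegral_ball_div hm1 fun R =>
      ((setLIntegral_le_lintegral _ _).trans_lt hF1.lt_top).ne,
    ae_lt_top hm1 hF1, ae_lt_top hm2 hF2] with s₀ hosc hmarg h1 h2 hpos
  set b : ℝ := ∫ θ, f (θ, s₀) with hb
  have hbL : b = (∫⁻ θ, ENNReal.ofReal (f (θ, s₀))).toReal :=
    integral_eq_lintegral_of_nonneg_ae (Eventually.of_forall fun θ => hf0 _)
      (hf.comp measurable_prodMk_right).aestronglyMeasurable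
  simp_rw [← lintegral_ballMass_eq hf] at hmarg
  have ha : Tendsto (fun r => ((∫⁻ θ, ballMass f s₀ r θ) / volume (Metric.ball s₀ r)).toReal)
      (𝓝[>] 0) (𝓝 b) := by
    rw [hbL]
    exact (ENNReal.tendsto_toReal h1.ne).comp hmarg
  refine ⟨h2.ne, fun r hr h0 => ?_, ?_⟩
  · have hev : ∀ᶠ r' in 𝓝[>] (0 : ℝ), r' ≤ r := by
      filter_upwards [Ioc_mem_nhdsGT hr] with r' hr' using hr'.2
    obtain ⟨r', h, hle⟩ := (((tendsto_order.1 ha).1 0 hpos).and hev).exists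
    have hle' : ∫⁻ θ, ballMass f s₀ r' θ ≤ ∫⁻ θ, ballMass f s₀ r θ :=
      lintegral_mono fun θ => lintegral_mono_set (Metric.ball_subset_ball hle)
    rw [h0, nonpos_iff_eq_zero] at hle'
    simp [hle'] at h
  · have hinv := ha.inv₀ hpos.ne'
    have hA := ENNReal.tendsto_ofReal (hinv.pow 2)
    have hB := ENNReal.tendsto_ofReal ((hinv.sub_const b⁻¹).pow 2)
    have hlim1 := ENNReal.Tendsto.const_mul (a := 2)
      (ENNReal.Tendsto.mul hA (Or.inr ENNReal.zero_ne_top) hosc (Or.inr ENNReal.ofReal_ne_top))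
      (Or.inr (by simp))
    have hlim2 := ENNReal.Tendsto.const_mul (a := 2)
      (ENNReal.Tendsto.mul_const (b := ∫⁻ θ, ENNReal.ofReal (f (θ, s₀) ^ 2)) hB (Or.inr h2.ne))
      (Or.inr (by simp))
    have hlim := hlim1.add hlim2
    simp only [mul_zero, sub_self, ne_eq, OfNat.ofNat_ne_zero, not_false_eq_true, zero_pow,
      ENNReal.ofReal_zero, zero_mul, add_zero] at hlim
    refine tendsto_of_tendsto_of_tendsto_of_le_of_le' tendsto_const_nhds hlim
      (Eventually.of_forall fun _ => zero_le) ?_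
    filter_upwards [self_mem_nhdsWithin] with r hr
    exact lintegral_ballDensity_sub_sq_le hf hf0 s₀ hr rfl b

/-- For balls of radius at least `δ` the conditional density is dominated by a multiple of the
prior density. -/
lemma lintegral_ballDensity_sub_sq_le_of_le (hf : Measurable f)
    {π g : E p → ℝ} (hπ0 : ∀ θ, 0 ≤ π θ)
    (hπ : ∀ᵐ θ, ∫⁻ s, ENNReal.ofReal (f (θ, s)) = ENNReal.ofReal (π θ))
    {s₀ : E m} {δ r : ℝ} (hδ0 : ∫⁻ θ, ballMass f s₀ δ θ ≠ 0) (hr : δ ≤ r) :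
    ∫⁻ θ, ENNReal.ofReal ((ballDensity f s₀ r θ - g θ) ^ 2)
      ≤ 2 * ((∫⁻ θ, ballMass f s₀ δ θ)⁻¹ ^ 2 * ∫⁻ θ, ENNReal.ofReal (π θ ^ 2))
        + 2 * ∫⁻ θ, ENNReal.ofReal (g θ ^ 2) := by
  have hq : ∫⁻ θ, ballMass f s₀ δ θ ≤ ∫⁻ θ, ballMass f s₀ r θ :=
    lintegral_mono fun θ => lintegral_mono_set (Metric.ball_subset_ball hr)
  have hsq := lintegral_ofReal_sub_sq_le (μ := (volume : Measure (E p)))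
    (a := ballDensity f s₀ r) (b := g) (c := fun _ => 0) (measurable_ballDensity hf s₀ r)
    measurable_const
  simp only [sub_zero, zero_sub, even_two, Even.neg_pow] at hsq
  refine hsq.trans ?_
  gcongr
  rw [← lintegral_const_mul' _ _ (ENNReal.pow_ne_top (ENNReal.inv_ne_top.2 hδ0))]
  refine lintegral_mono_ae ?_
  filter_upwards [hπ] with θ hθ
  rw [ballDensity, ENNReal.ofReal_pow ENNReal.toReal_nonneg, ENNReal.ofReal_pow (hπ0 θ), ← mul_pow]
  gcongr
  refine ENNReal.ofReal_toReal_le.trans ?_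
  rw [ENNReal.div_eq_inv_mul, ← hθ]
  gcongr
  exact setLIntegral_le_lintegral _ _

end BallDensity

/-! ### The nearest neighbour kernel estimate -/

section Model

variable {p m : ℕ} {prior : E p → ℝ} {lik : E p → E m → ℝ}

lemma IsBayesModel.measurable_jointDensity (hmodel : IsBayesModel prior lik) :
    Measurable (jointDensity prior lik) :=
  hmodel.lik_measurable.mul (hmodel.prior_measurable.comp measurable_fst)

lemma IsBayesModel.jointDensity_nonneg (hmodel : IsBayesModel prior lik) (x : E p × E m) :
    0 ≤ jointDensity prior lik x :=
  mul_nonneg (hmodel.lik_nonneg _ _) (hmodel.prior_nonneg _)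

lemma IsBayesModel.ae_lintegral_jointDensity (hmodel : IsBayesModel prior lik) :
    ∀ᵐ θ, ∫⁻ s, ENNReal.ofReal (jointDensity prior lik (θ, s)) = ENNReal.ofReal (prior θ) := by
  filter_upwards [hmodel.lik_integral] with θ hθ
  by_cases h0 : prior θ = 0
  · simp [jointDensity, h0]
  · have h1 := hθ h0
    have hi : Integrable (lik θ) := by
      by_contra hni
      exact zero_ne_one ((integral_undef hni).symm.trans h1)
    simp_rw [jointDensity, ENNReal.ofReal_mul (hmodel.lik_nonneg _ _)]
    rw [lintegral_mul_const' _ _ ENNReal.ofReal_ne_top, ← ofReal_integral_eq_lintegral_ofReal hi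
      (Eventually.of_forall fun s => hmodel.lik_nonneg _ _), h1, ENNReal.ofReal_one, one_mul]

variable {Ω : Type*} [MeasurableSpace Ω] {P : Measure Ω} [IsProbabilityMeasure P]
  {Θ : ℕ → Ω → E p} {S : ℕ → Ω → E m}

lemma IsIIDSample.isProbabilityMeasure (hsample : IsIIDSample prior lik P Θ S) :
    IsProbabilityMeasure ((volume : Measure (E p × E m)).withDensity
      fun x => ENNReal.ofReal (jointDensity prior lik x)) := by
  rw [← hsample.law 0]
  exact Measure.isProbabilityMeasure_map
    ((hsample.measurable_param 0).prodMk (hsample.measurable_stat 0)).aemeasurable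

lemma IsIIDSample.lintegral_jointDensity (hsample : IsIIDSample prior lik P Θ S) :
    ∫⁻ x, ENNReal.ofReal (jointDensity prior lik x) = 1 := by
  have h := hsample.isProbabilityMeasure.measure_univ
  rwa [withDensity_apply _ MeasurableSet.univ, Measure.restrict_univ] at h

lemma IsIIDSample.measurePreserving (hsample : IsIIDSample prior lik P Θ S) (N : ℕ) :
    MeasurePreserving (fun ω (i : Fin N) => (Θ i ω, S i ω)) P
      (Measure.pi fun _ => volume.withDensity fun x =>
        ENNReal.ofReal (jointDensity prior lik x)) := by
  have hm : ∀ i, Measurable fun ω => (Θ i ω, S i ω) := fun i =>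
    (hsample.measurable_param i).prodMk (hsample.measurable_stat i)
  refine ⟨measurable_pi_iff.2 fun i => hm i, ?_⟩
  have h := hsample.indep.precomp (g := fun i : Fin N => (i : ℕ)) Fin.val_injective
  rw [iIndepFun_iff_map_fun_eq_pi_map fun i => (hm _).aemeasurable] at h
  refine h.trans ?_
  congr 1
  funext i
  exact hsample.law i

/-- The estimate is the kernel density estimate of the parameters of the `k` nearest points. -/
lemma abcEstimate_eq {N k : ℕ} (hkN : k ≤ N) (K : E p → ℝ) (h : ℝ) (s₀ : E m)
    (x : Fin N → E p × E m) (θ₀ : E p) :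
    abcEstimate K k h s₀ (fun i => (x i).1) (fun i => (x i).2) θ₀
      = (Fintype.card (firstIndices k fun j => ‖(x j).2 - s₀‖) : ℝ)⁻¹
        * ∑ a : firstIndices k fun j => ‖(x j).2 - s₀‖,
          (h ^ p)⁻¹ * K (h⁻¹ • (θ₀ - (x a).1)) := by
  rw [Fintype.card_coe, card_firstIndices hkN, Finset.sum_coe_sort
    (firstIndices k fun j => ‖(x j).2 - s₀‖) fun a => (h ^ p)⁻¹ * K (h⁻¹ • (θ₀ - (x a).1)),
    firstIndices, Finset.sum_map, ← Finset.mul_sum, ← mul_assoc, ← mul_inv, abcEstimate, one_div]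
  rfl

/-- The part of the mean integrated square error that does not involve the conditional density of
the parameter given a ball: the variance `‖K‖² / (k hᵖ)` and the smoothing bias of the target `g`. -/
noncomputable def smoothingError (K g : E p → ℝ) (k : ℕ) (h : ℝ) : ℝ≥0∞ :=
  ENNReal.ofReal (h ^ p)⁻¹ * (∫⁻ u, ENNReal.ofReal (K u ^ 2)) / k
    + 2 * ∫⁻ u, ENNReal.ofReal (K u) * ∫⁻ θ, ENNReal.ofReal ((g (θ - h • u) - g θ) ^ 2)

lemma tendsto_smoothingError {K g : E p → ℝ} (hK : Measurable K)
    (hK1 : ∫⁻ u, ENNReal.ofReal (K u) ≠ ∞) (hK2 : ∫⁻ u, ENNReal.ofReal (K u ^ 2) ≠ ∞)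
    (hg : Measurable g) (hg2 : ∫⁻ θ, ENNReal.ofReal (g θ ^ 2) ≠ ∞) {k : ℕ → ℕ} {h : ℕ → ℝ}
    (hh : Tendsto h atTop (𝓝 0)) (hh0 : ∀ N, 0 < h N)
    (hkh : Tendsto (fun N => (k N : ℝ) * h N ^ p) atTop atTop) :
    Tendsto (fun N => smoothingError K g (k N) (h N)) atTop (𝓝 0) := by
  have h1 : Tendsto (fun N => ENNReal.ofReal (h N ^ p)⁻¹ * (∫⁻ u, ENNReal.ofReal (K u ^ 2)) / k N)
      atTop (𝓝 0) := by
    have ht := ENNReal.Tendsto.mul_const (b := ∫⁻ u, ENNReal.ofReal (K u ^ 2))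
      (ENNReal.tendsto_ofReal hkh.inv_tendsto_atTop) (Or.inr hK2)
    rw [ENNReal.ofReal_zero, zero_mul] at ht
    refine ht.congr' ?_
    filter_upwards [hkh.eventually_gt_atTop 0] with N hN
    have hk : (0 : ℝ) < k N := pos_of_mul_pos_left hN (by have := hh0 N; positivity)
    rw [Pi.inv_apply, mul_inv, ENNReal.ofReal_mul (by positivity), ENNReal.ofReal_inv_of_pos hk,
      ENNReal.ofReal_natCast, div_eq_mul_inv]
    ring
  have h2 := ENNReal.Tendsto.const_mul (a := 2) ((tendsto_lintegral_kernel_translate hg hg2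
    (K := fun u => ENNReal.ofReal (K u)) (by fun_prop) hK1).comp hh) (Or.inr (by simp))
  simpa [smoothingError] using h1.add h2

/-- Bound of the mean integrated square error by its contributions: smoothing, the distance to the
posterior of the conditional density given a ball of radius less than `δ`, and the unlikely event
that fewer points than needed fall in the ball of radius `δ`. -/
theorem mise_le (hm : 1 ≤ m) (hmodel : IsBayesModel prior lik)
    (hsample : IsIIDSample prior lik P Θ S) {K : E p → ℝ} (hK : IsKernelK1 K)
    (hK2 : ∫⁻ u, ENNReal.ofReal (K u ^ 2) ≠ ∞) {s₀ : E m} {N k : ℕ} (hk : 1 ≤ k) (hkN : k < N)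
    {h : ℝ} (hh : 0 < h) {δ : ℝ} {a b : ℝ≥0∞}
    (ha : ∀ r, 0 < r → r < δ → ∫⁻ θ, ENNReal.ofReal
      ((ballDensity (jointDensity prior lik) s₀ r θ - posteriorDensity prior lik θ s₀) ^ 2) ≤ a)
    (hb : ∀ r, δ ≤ r → ∫⁻ θ, ENNReal.ofReal
      ((ballDensity (jointDensity prior lik) s₀ r θ - posteriorDensity prior lik θ s₀) ^ 2) ≤ b) :
    mise prior lik P Θ S K s₀ N k h
      ≤ smoothingError K (fun θ => posteriorDensity prior lik θ s₀) k h + 2 * a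
        + (smoothingError K (fun θ => posteriorDensity prior lik θ s₀) k h + 2 * b)
          * Measure.pi (fun _ : Fin N => volume.withDensity fun x =>
              ENNReal.ofReal (jointDensity prior lik x))
            {x | (Finset.univ.filter fun j => ‖(x j).2 - s₀‖ < δ).card ≤ k} := by
  set f := jointDensity prior lik with hfdef
  set g : E p → ℝ := fun θ => posteriorDensity prior lik θ s₀ with hgdef
  set ρ : Measure (E p × E m) := volume.withDensity fun x => ENNReal.ofReal (f x) with hρ
  have hf : Measurable f := hmodel.measurable_jointDensity
  have hf1 : ∫⁻ x, ENNReal.ofReal (f x) ≠ ∞ := by simp [hfdef, hsample.lintegral_jointDensity]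
  have hg : Measurable g := (hf.comp measurable_prodMk_right).div_const _
  have hρp : IsProbabilityMeasure ρ := hsample.isProbabilityMeasure
  have hKm := hK.measurable
  set κ : E p → ℝ := fun u => (h ^ p)⁻¹ * K (h⁻¹ • u) with hκ
  have hκm : Measurable κ := by fun_prop
  have hκ0 : ∀ u, 0 ≤ κ u := fun u => mul_nonneg (by positivity) (hK.nonneg _)
  have hκ1 : ∫⁻ u, ENNReal.ofReal (κ u) = 1 := by
    have h1 := lintegral_rescaledKernel_mul hh hKm (F := fun _ => 1) measurable_const
    simp only [mul_one] at h1
    rw [h1, ← ofReal_integral_eq_lintegral_ofReal hK.integrable (Eventually.of_forall hK.nonneg),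
      hK.integral_eq_one, ENNReal.ofReal_one]
  have hκ2 := lintegral_rescaledKernel_sq hh hKm
  have : Nontrivial (E m) := by
    have : Nonempty (Fin m) := ⟨⟨0, hm⟩⟩
    infer_instance
  have hatom : ∀ r, ρ {w | ‖w.2 - s₀‖ = r} = 0 := by
    intro r
    refine withDensity_absolutelyContinuous _ _ ?_
    have : {w : E p × E m | ‖w.2 - s₀‖ = r} = Set.univ ×ˢ Metric.sphere s₀ r := by
      ext w; simp
    rw [this, Measure.volume_eq_prod, Measure.prod_prod, Measure.addHaar_sphere, mul_zero]
  let H : ∀ A : Finset (Fin N), (A → E p × E m) → ℝ≥0∞ := fun A x =>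
    ∫⁻ θ₀, ENNReal.ofReal (((Fintype.card A : ℝ)⁻¹ * ∑ a, κ (θ₀ - (x a).1) - g θ₀) ^ 2)
  have hH' : ∀ A : Finset (Fin N), Measurable fun x : A → E p => ∫⁻ θ₀, ENNReal.ofReal
      (((Fintype.card A : ℝ)⁻¹ * ∑ a, κ (θ₀ - x a) - g θ₀) ^ 2) := fun A =>
    Measurable.lintegral_prod_right' (f := fun z : (A → E p) × E p => ENNReal.ofReal
      (((Fintype.card A : ℝ)⁻¹ * ∑ a, κ (z.2 - z.1 a) - g z.2) ^ 2)) (by fun_prop)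
  have hfst : ∀ A : Finset (Fin N), Measurable fun (x : A → E p × E m) a => (x a).1 :=
    fun A => by fun_prop
  refine lintegral_nearest_le (H := H) hk hkN (d := fun w : E p × E m => ‖w.2 - s₀‖)
    (by fun_prop) hatom (fun A => (hH' A).comp (hfst A)) ?_ (hsample.measurePreserving N)
    (Ψ := fun x => ∫⁻ θ₀, ENNReal.ofReal
      ((abcEstimate K k h s₀ (fun i => (x i).1) (fun i => (x i).2) θ₀ - g θ₀) ^ 2)) ?_
  · intro A hA r hr
    have hr0 : 0 < r := by
      by_contra hle
      refine hr ?_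
      rw [setOf_norm_sub_lt_eq, Metric.ball_eq_empty.2 (not_lt.1 hle)]
      simp
    have hq : ∫⁻ θ, ballMass f s₀ r θ ≠ 0 := by rwa [← withDensity_ball hf]
    have : Nonempty A := (Finset.card_pos.1 (by omega)).to_subtype
    have := cond_isProbabilityMeasure hr
    have : IsProbabilityMeasure ((ρ[|{w | ‖w.2 - s₀‖ < r}]).map Prod.fst) :=
      Measure.isProbabilityMeasure_map measurable_fst.aemeasurable
    have hmap := Measure.pi_map_pi (μ := fun _ : A => ρ[|{w | ‖w.2 - s₀‖ < r}])
      (f := fun _ => Prod.fst) fun _ => measurable_fst.aemeasurable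
    have hkey : ∫⁻ x, H A x ∂Measure.pi (fun _ => ρ[|{w | ‖w.2 - s₀‖ < r}])
        ≤ smoothingError K g k h
          + 2 * ∫⁻ θ, ENNReal.ofReal ((ballDensity f s₀ r θ - g θ) ^ 2) := by
      rw [← lintegral_map (f := fun x : A → E p => ∫⁻ θ₀, ENNReal.ofReal
        (((Fintype.card A : ℝ)⁻¹ * ∑ a, κ (θ₀ - x a) - g θ₀) ^ 2)) (hH' A) (hfst A), hmap,
        map_fst_cond_ball hf hf1 hq]
      refine (lintegral_kernelDensityEstimate_sub_sq_le hκm hκ0 hκ1 ?_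
        (measurable_ballDensity hf s₀ r) (fun θ => ENNReal.toReal_nonneg)
        (lintegral_ofReal_ballDensity hf hf1 hq) hg).trans_eq ?_
      · rw [hκ2]
        exact ENNReal.mul_ne_top ENNReal.ofReal_ne_top hK2
      · rw [hκ2, Fintype.card_coe, hA, lintegral_rescaledKernel_mul hh hKm
          (F := fun u => ∫⁻ θ, ENNReal.ofReal ((g (θ - u) - g θ) ^ 2))
          (Measurable.lintegral_prod_right' (f := fun z : E p × E p =>
            ENNReal.ofReal ((g (z.2 - z.1) - g z.2) ^ 2)) (by fun_prop)), smoothingError]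
        ring
    refine hkey.trans ?_
    split_ifs with hδ
    · gcongr
      exact ha r hr0 hδ
    · gcongr
      exact hb r (not_lt.1 hδ)
  · intro x
    simp_rw [abcEstimate_eq hkN.le]
    exact le_rfl

end Model

/-! ### Convergence of the mean integrated square error -/

theorem theorem3 {p m : ℕ} (hp : 1 ≤ p) (hm : 1 ≤ m)
    (prior : E p → ℝ) (lik : E p → E m → ℝ) (hmodel : IsBayesModel prior lik)
    {Ω : Type*} [MeasurableSpace Ω] (P : Measure Ω) [IsProbabilityMeasure P]
    (Θ : ℕ → Ω → E p) (S : ℕ → Ω → E m) (hsample : IsIIDSample prior lik P Θ S)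
    (K : E p → ℝ) (hK : IsKernelK1 K) (hK2 : MemLp K 2 volume)
    (hf2 : MemLp (jointDensity prior lik) 2 volume)
    (hprior2 : MemLp prior 2 volume) :
    ∀ᵐ s₀ : E m, 0 < marginalDensity prior lik s₀ →
      ∀ (k : ℕ → ℕ) (h : ℕ → ℝ),
        (∀ N, 2 ≤ N → 1 ≤ k N ∧ k N ≤ N - 1) →
        (∀ N, 0 < h N) →
        Tendsto k atTop atTop →
        Tendsto (fun N => (k N : ℝ) / (N : ℝ)) atTop (𝓝 0) →
        Tendsto h atTop (𝓝 0) →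
        Tendsto (fun N => (k N : ℝ) * h N ^ p) atTop atTop →
        Tendsto (fun N => mise prior lik P Θ S K s₀ N (k N) (h N)) atTop (𝓝 0) := by
  classical
  set f := jointDensity prior lik with hfdef
  have hf : Measurable f := hmodel.measurable_jointDensity
  have hf0 : ∀ x, 0 ≤ f x := hmodel.jointDensity_nonneg
  have hf1 : ∫⁻ x, ENNReal.ofReal (f x) ≠ ∞ := by simp [hfdef, hsample.lintegral_jointDensity]
  have hK2' := lintegral_sq_ne_top_of_memLp hK2
  have hK1' : ∫⁻ u, ENNReal.ofReal (K u) ≠ ∞ := by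
    rw [← ofReal_integral_eq_lintegral_ofReal hK.integrable (Eventually.of_forall hK.nonneg)]
    exact ENNReal.ofReal_ne_top
  have hρp := hsample.isProbabilityMeasure
  filter_upwards [ae_tendsto_lintegral_ballDensity_sub_sq hf hf0 hf1
    (lintegral_sq_ne_top_of_memLp hf2)] with s₀ hs₀ hpos k h hk hh0 _ hkN hh hkh
  obtain ⟨hsec, hq, hlim⟩ := hs₀ hpos
  set g : E p → ℝ := fun θ => posteriorDensity prior lik θ s₀ with hgdef
  have hg : Measurable g := (hf.comp measurable_prodMk_right).div_const _
  have hg2 : ∫⁻ θ, ENNReal.ofReal (g θ ^ 2) ≠ ∞ := by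
    have hL : MemLp (fun θ => (∫ θ', f (θ', s₀))⁻¹ * f (θ, s₀)) 2 volume :=
      (memLp_two_of_lintegral_sq (hf.comp measurable_prodMk_right) hsec).const_mul _
    refine lintegral_sq_ne_top_of_memLp (hL.congr_norm hg.aestronglyMeasurable ?_)
    refine Eventually.of_forall fun θ => ?_
    simp only [hgdef, posteriorDensity, marginalDensity, div_eq_inv_mul, ← hfdef]
  have hsm := tendsto_smoothingError hK.measurable hK1' hK2' hg hg2 hh hh0 hkh
  rw [ENNReal.tendsto_nhds_zero]
  intro ε hε
  have hε4 : 0 < ε / 4 := ENNReal.div_pos hε.ne' (by simp)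
  obtain ⟨δ, hδ0, hδ⟩ : ∃ δ : ℝ, 0 < δ ∧ ∀ r, 0 < r → r < δ →
      ∫⁻ θ, ENNReal.ofReal ((ballDensity f s₀ r θ - g θ) ^ 2) ≤ ε / 4 := by
    have hev := (ENNReal.tendsto_nhds_zero.1 hlim) _ hε4
    obtain ⟨δ, hδ0, hδ⟩ := mem_nhdsGT_iff_exists_Ioo_subset.1 hev
    exact ⟨δ, hδ0, fun r h1 h2 => hδ ⟨h1, h2⟩⟩
  set C : ℝ≥0∞ := 2 * ((∫⁻ θ, ballMass f s₀ δ θ)⁻¹ ^ 2 * ∫⁻ θ, ENNReal.ofReal (prior θ ^ 2))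
        + 2 * ∫⁻ θ, ENNReal.ofReal (g θ ^ 2) with hC
  have hCt : C ≠ ∞ := by
    refine ENNReal.add_ne_top.2 ⟨ENNReal.mul_ne_top (by simp) (ENNReal.mul_ne_top ?_
      (lintegral_sq_ne_top_of_memLp hprior2)), ENNReal.mul_ne_top (by simp) hg2⟩
    exact ENNReal.pow_ne_top (ENNReal.inv_ne_top.2 (hq δ hδ0))
  have hfew := tendsto_measure_card_le
    (ρ := volume.withDensity fun x => ENNReal.ofReal (jointDensity prior lik x))
    (B := {w : E p × E m | ‖w.2 - s₀‖ < δ}) (measurableSet_lt (by fun_prop) measurable_const)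
    (by rw [withDensity_ball hf]; exact hq δ hδ0) hkN
  have hsum : Tendsto (fun N => smoothingError K g (k N) (h N)
      + (smoothingError K g (k N) (h N) + 2 * C) * Measure.pi (fun _ : Fin N =>
          volume.withDensity fun x => ENNReal.ofReal (jointDensity prior lik x))
        {x | (Finset.univ.filter fun j =>
          x j ∈ {w : E p × E m | ‖w.2 - s₀‖ < δ}).card ≤ k N}) atTop (𝓝 0) := by
    have h2C : 0 + 2 * C ≠ ∞ := by simpa using ENNReal.mul_ne_top (by simp) hCt
    have ht := hsm.add (ENNReal.Tendsto.mul (hsm.add_const (2 * C)) (Or.inr ENNReal.zero_ne_top)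
      hfew (Or.inr h2C))
    simpa using ht
  -- Only `P (fewer points than needed in the ball)` depends on the sample; it is multiplied by the
  -- constant `C`, while the balls of radius less than `δ` contribute at most `2 * (ε / 4)`.
  filter_upwards [(ENNReal.tendsto_nhds_zero.1 hsum) _ hε4, eventually_ge_atTop 2] with N hN hN2
  obtain ⟨hk1, hk2⟩ := hk N hN2
  refine (mise_le hm hmodel hsample hK hK2' hk1 (by omega) (hh0 N) hδ fun r hr =>
    lintegral_ballDensity_sub_sq_le_of_le hf hmodel.prior_nonneg
      hmodel.ae_lintegral_jointDensity (hq δ hδ0) hr).trans ?_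
  rw [add_right_comm]
  calc _ ≤ ε / 4 + 2 * (ε / 4) := by
        gcongr
    _ ≤ 4 * (ε / 4) := by
        rw [show (4 : ℝ≥0∞) * (ε / 4) = (1 + 3) * (ε / 4) by norm_num, add_mul, one_mul]
        gcongr
        norm_num
    _ = ε := ENNReal.mul_div_cancel (by simp) (by simp)
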